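/- \textbf{Setting.} Identify $(\mathfrak{so}(3),[\,,])$ with $(\mathbb{R}^3,\times)$, and let $I,K$ be symmetric positive definite $3\times 3$ real matrices (the inertia tensors of the body and of the rotors). On $Q=SO(3)\times\mathbb{T}^3$, $\mathbb T^3=\mathbb{S}^1\times\mathbb{S}^1\times\mathbb{S}^1$, consider the Lagrangian $L(R,\theta,\dot R,\dot\theta)=\tfrac12\langle\Omega,I\Omega\rangle+\tfrac12\langle\Omega+\dot\theta,K(\Omega+\dot\theta)\rangle$, $\Omega=R^{-1}\dot R$, and write $M=(I+K)^{-1}K$. A Lagrange--Poincaré (LP) bundle is a bundle $TX\oplus V\to X$ with a fibrewise Lie bracket on $V$, a $V$-valued 2-form $\omega$ and a linear connection $\nabla$ on $V$ such that $[X_1\oplus w_1,X_2\oplus w_2]=[X_1,X_2]\oplus(\nabla_{X_1}w_2-\nabla_{X_2}w_1-\omega(X_1,X_2)+[w_1,w_2])$ satisfies the Jacobi identity on sections. The LP equations of a Lagrangian $l(x,\dot x,v)$ are the vertical equation $\frac{D}{dt}\frac{\partial l}{\partial v}=\mathrm{ad}^*_v\frac{\partial l}{\partial v}$, where $\langle \mathrm{ad}^*_v\mu,w\rangle=\langle\mu,[v,w]\rangle$,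 and the horizontal equation $\frac{D}{dt}\frac{\partial l}{\partial\dot x}-\frac{\partial l}{\partial x}+\langle\frac{\partial l}{\partial v},\omega(\dot x,\cdot)\rangle=0$, where $\partial l/\partial x$ is the derivative along horizontal lifts for $\nabla$ (the tangent bundle of the torus carries its flat connection). The curvature of a principal connection $A$ is $B=dA(\mathrm{Hor}\,\cdot,\mathrm{Hor}\,\cdot)$. \textbf{First stage.} Let $SO(3)$ act on $Q$ by left translations. (1) $A_{R,\theta}(\dot R,\dot\theta)=\mathrm{Ad}_R(R^{-1}\dot R+M\dot\theta)$ is a principal connection on $Q\to\mathbb T^3$. It is the mechanical connection: its horizontal spaces are the orthogonal complements of the vertical ones for the metric with kinetic energy $L$. The map $[R,\theta,\dot R,\dot\theta]\mapsto(\theta,\dot\theta,\xi)$, $\xi=\mathrm{Ad}_{R^{-1}}A_{R,\theta}(\dot R,\dot\theta)=\Omega+M\dot\theta$, is an isomorphism $TQ/SO(3)\cong T\mathbb T^3\oplus(\mathbb T^3\times\mathfrak{so}(3))$. (2) The adjoint bundle $(Q\times\mathfrak{so}(3))/SO(3)$ is trivialized by $[(R,\theta),\zeta]\mapsto(\theta,\mathrm{Ad}_{R^{-1}}\zeta)$.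 In this trivialization its bracket $[[q,\zeta_1],[q,\zeta_2]]=[q,\zeta_1\times\zeta_2]$, its covariant derivative $\frac{D}{dt}[q,\zeta]=[q,\dot\zeta-A(\dot q)\times\zeta]$ and the 2-form $[q,B(\mathrm{Hor}_q\cdot,\mathrm{Hor}_q\cdot)]$ become respectively the cross product, $\frac{D\alpha}{dt}=\dot\alpha-(M\dot\theta)\times\alpha$, and $$\tilde B_\theta(\dot\theta,\dot\varphi)=(M\dot\varphi)\times(M\dot\theta),$$ which is not zero at any $\theta$. With this structure $T\mathbb T^3\oplus(\mathbb T^3\times\mathfrak{so}(3))$ is an LP bundle. (3) $L$ drops to the decoupled Lagrangian $l_1(\theta,\dot\theta,\xi)=\tfrac12\langle\xi,(I+K)\xi\rangle+\tfrac12\langle K\dot\theta,(I+K)^{-1}I\dot\theta\rangle$. (4) Write $\Omega=\xi-M\dot\theta$. Along curves $(\theta,\dot\theta,\xi)$ the vertical LP equation of $l_1$ is equivalent to $(I+K)\dot\xi=((I+K)\xi)\times\Omega$, and the horizontal one to $I\ddot\theta=-((I+K)\xi)\times\Omega$. \textbf{Second stage.} (5) The LP structure and $l_1$ are invariant under the action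 $\varphi\cdot(\theta,\dot\theta,\xi)=(\theta+\varphi,\dot\theta,\xi)$ of $\mathbb T^3$, and $[\theta,\dot\theta,\xi]\mapsto(\Omega_r=\dot\theta,\xi)$ identifies the quotient with $\mathbb R^3\oplus\mathfrak{so}(3)$. The reduced LP bundle for the connection $A_\theta(\dot\theta)=\dot\theta$ is $\mathbb R^3\oplus\mathfrak{so}(3)$ over a point, with $\nabla=0$, $\omega=0$ and the Lie bracket $$[(\Omega_{r,1},\xi_1),(\Omega_{r,2},\xi_2)]=0\oplus\big(-(M\Omega_{r,1})\times\xi_2+(M\Omega_{r,2})\times\xi_1-(M\Omega_{r,2})\times(M\Omega_{r,1})+\xi_1\times\xi_2\big).$$ The reduced Lagrangian is $l_2(\Omega_r,\xi)=\tfrac12\langle\xi,(I+K)\xi\rangle+\tfrac12\langle K\Omega_r,(I+K)^{-1}I\Omega_r\rangle$. (6) There is no horizontal equation (it holds trivially). With $\Omega=\xi-M\Omega_r$, the vertical equation of $l_2$ is equivalent to the pair $I\dot\Omega_r=-((I+K)\xi)\times\Omega$ and $(I+K)\dot\xi=((I+K)\xi)\times\Omega$. \textbf{Equivalence.} (7)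 $L$ equals the Euler--Poincaré Lagrangian $\ell(\Omega,\Omega_r)=\tfrac12\langle\Omega,I\Omega\rangle+\tfrac12\langle\Omega+\Omega_r,K(\Omega+\Omega_r)\rangle$ on $\mathfrak{so}(3)\oplus\mathbb R^3$ (bracket $(\alpha_1\times\alpha_2,0)$), evaluated at $\Omega=R^{-1}\dot R$, $\Omega_r=\dot\theta$. Along every twice differentiable curve $(R(t),\theta(t))$ in $Q$, with $\Omega=R^{-1}\dot R$, $\Omega_r=\dot\theta$, $\xi=\Omega+M\Omega_r$, the following are equivalent at each time: the two LP equations of the first stage; the vertical equation of the second stage; the Euler--Poincaré equations of $\ell$; the pair $(I+K)\dot\Omega+K\dot\Omega_r=((I+K)\Omega+K\Omega_r)\times\Omega$, $K\dot\Omega_r+K\dot\Omega=0$. Moreover the vertical equation of the first stage alone is equivalent to the first equation of this pair. -/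

import Mathlib

open Matrix
open scoped ContDiff Topology

noncomputable section

namespace Rotor

/-! ## Lagrange-Poincare bundles over a torus (a point is the torus of dimension `0`) -/

/-- The torus `S¹ × ⋯ × S¹`, written additively. -/
abbrev Torus (n : ℕ) : Type := Fin n → Real.Angle

/-- The covering map `ℝⁿ → Tⁿ`. -/
def toTorus {n : ℕ} (x : Fin n → ℝ) : Torus n := fun i => (x i : Real.Angle)

/-- `u` is the velocity of the curve `θ` at time `t`: the derivative is taken in the chart of the
circle given by the signed angle measured from `θ t`. -/
def HasTorusVelocityAt {n : ℕ} (θ : ℝ → Torus n) (u : Fin n → ℝ) (t : ℝ) : Prop :=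
  ∀ i, HasDerivAt (fun s => (θ s i - θ t i).toReal) (u i) t

/-- Derivative at `θ` of a function on the torus in the direction `X ∈ T_θ Tⁿ = ℝⁿ`. -/
def dirDeriv {n : ℕ} {E : Type*} [NormedAddCommGroup E] [NormedSpace ℝ E]
    (f : Torus n → E) (θ : Torus n) (X : Fin n → ℝ) : E :=
  deriv (fun s : ℝ => f (θ + toTorus (s • X))) 0

/-- Smooth functions on the torus: smooth after pull-back along the covering `ℝⁿ → Tⁿ`. -/
def TorusSmooth {n : ℕ} {E : Type*} [NormedAddCommGroup E] [NormedSpace ℝ E]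
    (f : Torus n → E) : Prop :=
  ContDiff ℝ ∞ (fun x : Fin n → ℝ => f (toTorus x))

/-- The additional structure on `T(Tⁿ) ⊕ V`, where `V = Tⁿ × F` is a trivialized vector bundle:
a fibrewise bracket, a `V`-valued 2-form and a linear connection `∇_X w = dw(X) + conn X w`. The
laws are in `LPStructure.IsLP`. -/
structure LPStructure (n : ℕ) (F : Type) where
  bracket : Torus n → F → F → F
  form : Torus n → (Fin n → ℝ) → (Fin n → ℝ) → F
  conn : Torus n → (Fin n → ℝ) → F → F

section LP

variable {n : ℕ} {F : Type} [NormedAddCommGroup F] [NormedSpace ℝ F]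

/-- The covariant derivative `∇_X w` of a section `w` along a vector field `X`. -/
def LPStructure.nabla (P : LPStructure n F) (X : Torus n → Fin n → ℝ) (w : Torus n → F) :
    Torus n → F :=
  fun θ => dirDeriv w θ (X θ) + P.conn θ (X θ) (w θ)

/-- The covariant derivative `Dα/Dt` of a curve `α` in `V` over a curve `θ` with velocity `u`. -/
def LPStructure.covDeriv (P : LPStructure n F) (θ : ℝ → Torus n) (u : ℝ → Fin n → ℝ)
    (α : ℝ → F) (t : ℝ) : F :=
  deriv α t + P.conn (θ t) (u t) (α t)

/-- The bracket
`[X₁ ⊕ w₁, X₂ ⊕ w₂] = [X₁, X₂] ⊕ (∇_{X₁} w₂ - ∇_{X₂} w₁ - ω(X₁, X₂) + [w₁, w₂])`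
of sections of `T(Tⁿ) ⊕ V`. -/
def LPStructure.sectionBracket (P : LPStructure n F)
    (x y : (Torus n → Fin n → ℝ) × (Torus n → F)) :
    (Torus n → Fin n → ℝ) × (Torus n → F) :=
  (fun θ => dirDeriv y.1 θ (x.1 θ) - dirDeriv x.1 θ (y.1 θ),
   fun θ => P.nabla x.1 y.2 θ - P.nabla y.1 x.2 θ - P.form θ (x.1 θ) (y.1 θ)
      + P.bracket θ (x.2 θ) (y.2 θ))

/-- The laws of a Lagrange-Poincare bundle. -/
structure LPStructure.IsLP (P : LPStructure n F) : Prop where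
  bracket_bilin : ∀ θ, ∃ b : F →ₗ[ℝ] F →ₗ[ℝ] F, ∀ v w, P.bracket θ v w = b v w
  bracket_self : ∀ θ v, P.bracket θ v v = 0
  bracket_jacobi : ∀ θ v w z, P.bracket θ (P.bracket θ v w) z + P.bracket θ (P.bracket θ w z) v
    + P.bracket θ (P.bracket θ z v) w = 0
  bracket_smooth : ∀ v w, TorusSmooth (fun θ => P.bracket θ v w)
  form_bilin : ∀ θ, ∃ b : (Fin n → ℝ) →ₗ[ℝ] (Fin n → ℝ) →ₗ[ℝ] F, ∀ X Y, P.form θ X Y = b X Y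
  form_self : ∀ θ X, P.form θ X X = 0
  form_smooth : ∀ X Y, TorusSmooth (fun θ => P.form θ X Y)
  conn_bilin : ∀ θ, ∃ b : (Fin n → ℝ) →ₗ[ℝ] F →ₗ[ℝ] F, ∀ X v, P.conn θ X v = b X v
  conn_smooth : ∀ X v, TorusSmooth (fun θ => P.conn θ X v)
  section_jacobi : ∀ x y z : (Torus n → Fin n → ℝ) × (Torus n → F),
    TorusSmooth x.1 → TorusSmooth x.2 → TorusSmooth y.1 → TorusSmooth y.2 →
    TorusSmooth z.1 → TorusSmooth z.2 →
    P.sectionBracket (P.sectionBracket x y) z + P.sectionBracket (P.sectionBracket y z) x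
      + P.sectionBracket (P.sectionBracket z x) y = 0

/-- Lagrangians `l(θ, θ̇, v)` on `T(Tⁿ) ⊕ V`. -/
abbrev Lagr (n : ℕ) (F : Type) : Type := Torus n → (Fin n → ℝ) → F → ℝ

/-- `∂l/∂v`, an element of the dual of the fibre. -/
def dFiber (l : Lagr n F) (θ : Torus n) (u : Fin n → ℝ) (v : F) : F →L[ℝ] ℝ :=
  fderiv ℝ (fun w => l θ u w) v

/-- `∂l/∂θ̇`. -/
def dVel (l : Lagr n F) (θ : Torus n) (u : Fin n → ℝ) (v : F) : (Fin n → ℝ) →L[ℝ] ℝ :=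
  fderiv ℝ (fun w => l θ w v) u

/-- The connection-dependent derivative `∂l/∂θ` in the direction `X`: the derivative of `l` in the
direction of the horizontal lift of `X` at `(θ, u, v)`. The tangent bundle of the torus carries
its trivial connection, so `u` stays constant; a horizontal curve `v(s)` in `V` satisfies
`v' = -conn X v`, so its tangent at `v` is `-conn X v`. -/
def LPStructure.dBase (P : LPStructure n F) (l : Lagr n F) (θ : Torus n) (u : Fin n → ℝ) (v : F)
    (X : Fin n → ℝ) : ℝ :=
  deriv (fun s : ℝ => l (θ + toTorus (s • X)) u (v - s • P.conn θ X v)) 0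

/-- The vertical Lagrange-Poincare equation `D/Dt (∂l/∂v) = ad*_v (∂l/∂v)` at time `t`, evaluated
on every `α`, with `⟨Dμ/Dt, α⟩ = d/dt ⟨μ, α⟩ - ⟨μ, Dα/Dt⟩` (this depends only on the value of the
curve `α` at time `t`, so constant curves are used) and `ad*_v μ (α) = μ([v, α])`. -/
def LPStructure.VerticalEq (P : LPStructure n F) (l : Lagr n F)
    (θ : ℝ → Torus n) (u : ℝ → Fin n → ℝ) (v : ℝ → F) (t : ℝ) : Prop :=
  ∀ α : F,
    deriv (fun s => dFiber l (θ s) (u s) (v s) α) t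
        - dFiber l (θ t) (u t) (v t) (P.covDeriv θ u (fun _ => α) t)
      = dFiber l (θ t) (u t) (v t) (P.bracket (θ t) (v t) α)

/-- The horizontal Lagrange-Poincare equation
`D/Dt (∂l/∂θ̇) - ∂l/∂θ + ⟨∂l/∂v, ω(θ̇, ·)⟩ = 0` at time `t`. -/
def LPStructure.HorizontalEq (P : LPStructure n F) (l : Lagr n F)
    (θ : ℝ → Torus n) (u : ℝ → Fin n → ℝ) (v : ℝ → F) (t : ℝ) : Prop :=
  ∀ X : Fin n → ℝ,
    deriv (fun s => dVel l (θ s) (u s) (v s) X) t - P.dBase l (θ t) (u t) (v t) X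
      + dFiber l (θ t) (u t) (v t) (P.form (θ t) (u t) X) = 0

/-- The reduction of `T(Tⁿ) ⊕ V` by the action of `Tⁿ` on itself by translations (trivial on the
fibre `F`), with the connection `A_θ(θ̇) = θ̇`: a Lagrange-Poincare bundle over a point with fibre
`ℝⁿ ⊕ V/Tⁿ = ℝⁿ ⊕ F`. Invariant sections of `V` and invariant vector fields are constant, so the
vertical quotient connection is `[∇^{(A,V)}]_ξ [v] = ∇_ξ v` for constant `ξ`, `v`, read at the
point `0` of the torus; tangent vectors to the point have horizontal lift `0`; and
`[ξ₁ ⊕ v₁, ξ₂ ⊕ v₂] = [ξ₁, ξ₂] ⊕ ([∇^V]_{ξ₁} v₂ - [∇^V]_{ξ₂} v₁ - ω(ξ₁, ξ₂) + [v₁, v₂])` with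
`[ξ₁, ξ₂] = 0`. -/
def LPStructure.torusQuotient (P : LPStructure n F) : LPStructure 0 ((Fin n → ℝ) × F) where
  bracket _ x y :=
    (0, P.nabla (fun _ => x.1) (fun _ => y.2) 0 - P.nabla (fun _ => y.1) (fun _ => x.2) 0
      - P.form 0 x.1 y.1 + P.bracket 0 x.2 y.2)
  form _ _ _ := (0, P.form 0 0 0)
  conn _ _ x := (0, P.conn 0 0 x.2 - P.form 0 0 x.1)

end LP

/-! ## The configuration space `SO(3) × T³` -/

abbrev V3 : Type := Fin 3 → ℝ

abbrev Mat3 : Type := Matrix (Fin 3) (Fin 3) ℝ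

abbrev SO3 : Type := Matrix.specialOrthogonalGroup (Fin 3) ℝ

/-- The identification of `ℝ³` (with the cross product) with `so(3)`. -/
def hat (v : V3) : Mat3 := !![0, -v 2, v 1; v 2, 0, -v 0; -v 1, v 0, 0]

/-- The inverse of `hat` on skew-symmetric matrices. -/
def vee (S : Mat3) : V3 := ![S 2 1, S 0 2, S 1 0]

theorem hat_add (v w : V3) : hat (v + w) = hat v + hat w := by
  ext i j; fin_cases i <;> fin_cases j <;> simp [hat] <;> ring

theorem hat_smul (c : ℝ) (v : V3) : hat (c • v) = c • hat v := by
  ext i j; fin_cases i <;> fin_cases j <;> simp [hat]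

theorem hat_transpose (v : V3) : (hat v)ᵀ = -hat v := by
  ext i j; fin_cases i <;> fin_cases j <;> simp [hat]

theorem vee_add (S T : Mat3) : vee (S + T) = vee S + vee T := by
  ext i; fin_cases i <;> simp [vee]

theorem vee_smul (c : ℝ) (S : Mat3) : vee (c • S) = c • vee S := by
  ext i; fin_cases i <;> simp [vee]

theorem SO3.transpose_mul_self (R : SO3) : (R : Mat3)ᵀ * (R : Mat3) = 1 :=
  (mem_orthogonalGroup_iff' (Fin 3) ℝ).1 (mem_specialOrthogonalGroup_iff.1 R.2).1

theorem SO3.mul_transpose_self (R : SO3) : (R : Mat3) * (R : Mat3)ᵀ = 1 :=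
  (mem_orthogonalGroup_iff (Fin 3) ℝ).1 (mem_specialOrthogonalGroup_iff.1 R.2).1

theorem exp_hat_mem (v : V3) :
    NormedSpace.exp (hat v) ∈ Matrix.specialOrthogonalGroup (Fin 3) ℝ := by
  have key : ∀ w : V3, NormedSpace.exp (hat w) * (NormedSpace.exp (hat w))ᵀ = 1 := by
    intro w
    rw [← Matrix.exp_transpose, hat_transpose,
      ← Matrix.exp_add_of_commute _ _ (Commute.refl (hat w)).neg_right, add_neg_cancel,
      NormedSpace.exp_zero]
  have hsq : NormedSpace.exp (hat v)
      = NormedSpace.exp (hat ((1 / 2 : ℝ) • v)) * NormedSpace.exp (hat ((1 / 2 : ℝ) • v)) := by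
    rw [← Matrix.exp_add_of_commute _ _ (Commute.refl _), ← hat_add, ← add_smul]
    norm_num
  refine mem_specialOrthogonalGroup_iff.2 ⟨(mem_orthogonalGroup_iff (Fin 3) ℝ).2 (key v), ?_⟩
  have hd := congrArg Matrix.det (key ((1 / 2 : ℝ) • v))
  rw [Matrix.det_mul, Matrix.det_transpose, Matrix.det_one] at hd
  rw [hsq, Matrix.det_mul, hd]

/-- The exponential map `ℝ³ = so(3) → SO(3)`. -/
def expSO3 (v : V3) : SO3 := ⟨NormedSpace.exp (hat v), exp_hat_mem v⟩

/-- The adjoint action of `SO(3)` on `so(3) = ℝ³`: `Ad_R v = R v R⁻¹`. -/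
def Ad (R : SO3) : V3 →ₗ[ℝ] V3 where
  toFun v := vee ((R : Mat3) * hat v * (R : Mat3)ᵀ)
  map_add' v w := by rw [hat_add, Matrix.mul_add, Matrix.add_mul, vee_add]
  map_smul' c v := by rw [hat_smul, Matrix.mul_smul, Matrix.smul_mul, vee_smul]; rfl

/-- The configuration space `Q = SO(3) × S¹ × S¹ × S¹`. -/
abbrev Q : Type := SO3 × Torus 3

/-- The tangent space of `Q` at `(R, θ)`: pairs `(Ṙ, θ̇)` with `R⁻¹ Ṙ` skew-symmetric. -/
def tangentQ (q : Q) : Submodule ℝ (Mat3 × V3) where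
  carrier := {v | ((q.1 : Mat3)ᵀ * v.1)ᵀ = -((q.1 : Mat3)ᵀ * v.1)}
  add_mem' {v w} hv hw := by
    change ((q.1 : Mat3)ᵀ * v.1)ᵀ = -((q.1 : Mat3)ᵀ * v.1) at hv
    change ((q.1 : Mat3)ᵀ * w.1)ᵀ = -((q.1 : Mat3)ᵀ * w.1) at hw
    change ((q.1 : Mat3)ᵀ * (v + w).1)ᵀ = -((q.1 : Mat3)ᵀ * (v + w).1)
    rw [Prod.fst_add, Matrix.mul_add, Matrix.transpose_add, hv, hw, neg_add]
  zero_mem' := by simp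
  smul_mem' c v hv := by
    change ((q.1 : Mat3)ᵀ * v.1)ᵀ = -((q.1 : Mat3)ᵀ * v.1) at hv
    change ((q.1 : Mat3)ᵀ * (c • v).1)ᵀ = -((q.1 : Mat3)ᵀ * (c • v).1)
    rw [Prod.smul_fst, Matrix.mul_smul, Matrix.transpose_smul, hv, smul_neg]

/-- The tangent bundle `TQ`. -/
abbrev TQ : Type := Σ q : Q, tangentQ q

/-- `w` is the velocity of the curve `q` at time `t`. -/
def HasVelocityAt (q : ℝ → Q) (t : ℝ) (w : tangentQ (q t)) : Prop :=
  (∀ i j, HasDerivAt (fun s => ((q s).1 : Mat3) i j) (w.1.1 i j) t) ∧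
    HasTorusVelocityAt (fun s => (q s).2) w.1.2 t

/-- The body angular velocity `Ω = R⁻¹ Ṙ ∈ so(3) = ℝ³`. -/
def bodyVel (q : Q) : tangentQ q →ₗ[ℝ] V3 where
  toFun v := vee ((q.1 : Mat3)ᵀ * v.1.1)
  map_add' v w := by
    rw [Submodule.coe_add, Prod.fst_add, Matrix.mul_add, vee_add]
  map_smul' c v := by
    rw [Submodule.coe_smul, Prod.smul_fst, Matrix.mul_smul, vee_smul]; rfl

/-- The rotor angular velocity `Ω_r = θ̇ ∈ ℝ³`. -/
def rotorVel (q : Q) : tangentQ q →ₗ[ℝ] V3 :=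
  (LinearMap.snd ℝ Mat3 V3).comp (tangentQ q).subtype

/-- The left-invariant vector field on the Lie group `Q` with value `x ∈ so(3) ⊕ ℝ³` at the
identity. -/
def leftInv (x : V3 × V3) (q : Q) : tangentQ q :=
  ⟨((q.1 : Mat3) * hat x.1, x.2), by
    change ((q.1 : Mat3)ᵀ * ((q.1 : Mat3) * hat x.1))ᵀ
      = -((q.1 : Mat3)ᵀ * ((q.1 : Mat3) * hat x.1))
    rw [← Matrix.mul_assoc, SO3.transpose_mul_self, Matrix.one_mul, hat_transpose]⟩

/-- The flow `q ↦ q · exp(s x)` of the left-invariant vector field `leftInv x`. -/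
def leftFlow (x : V3 × V3) (s : ℝ) (q : Q) : Q :=
  (q.1 * expSO3 (s • x.1), q.2 + toTorus (s • x.2))

/-- The action of `SO(3)` on `Q` by left translations. -/
def act (g : SO3) (q : Q) : Q := (g * q.1, q.2)

/-- The tangent map of the action of `g`. -/
def tangentAct (g : SO3) (q : Q) (v : tangentQ q) : tangentQ (act g q) :=
  ⟨((g : Mat3) * v.1.1, v.1.2), by
    have hv : ((q.1 : Mat3)ᵀ * v.1.1)ᵀ = -((q.1 : Mat3)ᵀ * v.1.1) := v.2
    change (((g : Mat3) * (q.1 : Mat3))ᵀ * ((g : Mat3) * v.1.1))ᵀ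
      = -(((g : Mat3) * (q.1 : Mat3))ᵀ * ((g : Mat3) * v.1.1))
    have h : ((g : Mat3) * (q.1 : Mat3))ᵀ * ((g : Mat3) * v.1.1) = (q.1 : Mat3)ᵀ * v.1.1 := by
      rw [Matrix.transpose_mul, Matrix.mul_assoc, ← Matrix.mul_assoc _ (g : Mat3) v.1.1,
        SO3.transpose_mul_self, Matrix.one_mul]
    rw [h, hv]⟩

/-- The infinitesimal generator of `ζ ∈ so(3)`, the tangent vector at time `0` of
`exp(t ζ) · q`. -/
def generator (ζ : V3) (q : Q) : tangentQ q :=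
  ⟨(hat ζ * (q.1 : Mat3), 0), by
    change ((q.1 : Mat3)ᵀ * (hat ζ * (q.1 : Mat3)))ᵀ = -((q.1 : Mat3)ᵀ * (hat ζ * (q.1 : Mat3)))
    rw [Matrix.transpose_mul, Matrix.transpose_mul, hat_transpose, Matrix.transpose_transpose,
      Matrix.mul_neg, Matrix.neg_mul, Matrix.mul_assoc]⟩

open scoped Matrix.Norms.Operator in
/-- `generator ζ q` is the velocity at time `0` of the curve `exp(t ζ) · q` through `q`. -/
theorem generator_spec (ζ : V3) (q : Q) :
    (∀ i j, HasDerivAt (fun s : ℝ => ((act (expSO3 (s • ζ)) q).1 : Mat3) i j)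
      ((generator ζ q).1.1 i j) 0) ∧
    HasTorusVelocityAt (fun s : ℝ => (act (expSO3 (s • ζ)) q).2) (generator ζ q).1.2 0 := by
  constructor
  · intro i j
    have h0 := (hasDerivAt_exp_smul_const (𝕂 := ℝ) (hat ζ) 0).mul_const (q.1 : Mat3)
    rw [zero_smul, NormedSpace.exp_zero, Matrix.one_mul] at h0
    have h1 := (LinearMap.toContinuousLinearMap
      (Matrix.entryLinearMap ℝ ℝ i j)).hasFDerivAt.comp_hasDerivAt (0 : ℝ) h0
    simp only [act, expSO3, hat_smul, generator]
    exact h1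
  · intro i
    simpa [act, generator] using hasDerivAt_const (0 : ℝ) (0 : ℝ)

/-- The quotient `TQ / SO(3)`. -/
abbrev TQmodSO3 : Type := Quot (fun x y : TQ => ∃ g : SO3, y = ⟨act g x.1, tangentAct g x.1 x.2⟩)

/-- The adjoint bundle `(Q × so(3)) / SO(3)`. -/
abbrev AdjointBundle : Type :=
  Quot (fun x y : Q × V3 => ∃ g : SO3, y = (act g x.1, Ad g x.2))

/-- The element `[q, ζ]` of the adjoint bundle. -/
def adjMk (q : Q) (ζ : V3) : AdjointBundle := Quot.mk _ (q, ζ)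

/-! ## Connections on `Q → T³` -/

/-- `so(3)`-valued 1-forms on `Q`. -/
abbrev OneForm : Type := ∀ q : Q, tangentQ q →ₗ[ℝ] V3

/-- Principal connections on `Q → Q/SO(3) = T³`. The last condition says that `A` is smooth: its
values on the left-invariant frame are smooth functions on `Q`, read in exponential charts. -/
def IsPrincipalConnection (A : OneForm) : Prop :=
  (∀ q ζ, A q (generator ζ q) = ζ) ∧
  (∀ g q v, A (act g q) (tangentAct g q v) = Ad g (A q v)) ∧
  (∀ x q, ContDiff ℝ ∞ (fun z : V3 × V3 => A (leftFlow z 1 q) (leftInv x (leftFlow z 1 q))))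

/-- The exterior derivative `dA(X, Y) = X(A(Y)) - Y(A(X)) - A([X, Y])`, where `X` and `Y` are the
left-invariant vector fields that extend `v` and `w`; their bracket is the left-invariant field
of the Lie bracket in `so(3) ⊕ ℝ³`. -/
def extDerivForm (A : OneForm) (q : Q) (v w : tangentQ q) : V3 :=
  let x : V3 × V3 := (bodyVel q v, rotorVel q v)
  let y : V3 × V3 := (bodyVel q w, rotorVel q w)
  deriv (fun s : ℝ => A (leftFlow x s q) (leftInv y (leftFlow x s q))) 0
    - deriv (fun s : ℝ => A (leftFlow y s q) (leftInv x (leftFlow y s q))) 0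
    - A q (leftInv (x.1 ⨯₃ y.1, 0) q)

/-- The horizontal projection `T_q Q → H_q Q` along the vertical space. -/
def horProj (A : OneForm) (q : Q) (v : tangentQ q) : tangentQ q := v - generator (A q v) q

/-- The curvature `B(v, w) = dA(Hor v, Hor w)`. -/
def curvature (A : OneForm) (q : Q) (v w : tangentQ q) : V3 :=
  extDerivForm A q (horProj A q v) (horProj A q w)

/-- The horizontal lift at `q = (R, θ)` of `X ∈ T_θ T³`: the horizontal part of `(0, X)`. -/
def horLift (A : OneForm) (q : Q) (X : V3) : tangentQ q :=
  horProj A q ⟨(0, X), by simp [tangentQ]⟩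

/-- The Lagrange-Poincare structure on `T(T³) ⊕ (T³ × so(3))` obtained from reduction of `TQ` by
`SO(3)` with the connection `A`, the adjoint bundle being trivialized by `[(1, θ), α] ↦ (θ, α)`:
the bracket `[[q, ζ₁], [q, ζ₂]] = [q, ζ₁ × ζ₂]`, the 2-form
`[q, B(Hor_q X, Hor_q Y)]`, and the connection `D[q, α]/Dt = [q, α' - A(q̇) × α]`,
all read at `q = (1, θ)`. -/
def reducedBySO3 (A : OneForm) : LPStructure 3 V3 where
  bracket _ α β := α ⨯₃ β
  form θ X Y := curvature A (1, θ) (horLift A (1, θ) X) (horLift A (1, θ) Y)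
  conn θ X α := -(A (1, θ) (leftInv (0, X) (1, θ)) ⨯₃ α)

/-! ## The rigid body with rotors -/

/-- The Riemannian metric on `Q` whose kinetic energy is the Lagrangian. -/
def metric (I K : Mat3) (q : Q) (v w : tangentQ q) : ℝ :=
  bodyVel q w ⬝ᵥ (I *ᵥ bodyVel q v)
    + (bodyVel q w + rotorVel q w) ⬝ᵥ (K *ᵥ (bodyVel q v + rotorVel q v))

/-- The Lagrangian of the free rigid body with rotors. -/
def lagrangian (I K : Mat3) (q : Q) (v : tangentQ q) : ℝ :=
  1 / 2 * (bodyVel q v ⬝ᵥ (I *ᵥ bodyVel q v))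
    + 1 / 2 * ((bodyVel q v + rotorVel q v) ⬝ᵥ (K *ᵥ (bodyVel q v + rotorVel q v)))

/-- The connection `A(Ṙ, θ̇) = Ad_R (R⁻¹ Ṙ + (I + K)⁻¹ K θ̇)`. -/
def mechConnection (I K : Mat3) : OneForm := fun q =>
  (Ad q.1).comp (bodyVel q + (Matrix.mulVecLin ((I + K)⁻¹ * K)).comp (rotorVel q))

/-- The structure obtained from the first reduction, by `SO(3)`. -/
def stage1 (I K : Mat3) : LPStructure 3 V3 := reducedBySO3 (mechConnection I K)

/-- The structure obtained from the second reduction, by `T³`. -/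
def stage2 (I K : Mat3) : LPStructure 0 (V3 × V3) := (stage1 I K).torusQuotient

/-- The reduced Lagrangian `l(θ, θ̇, ξ)` of the first stage. -/
def lagr1 (I K : Mat3) : Lagr 3 V3 := fun _ u ξ =>
  1 / 2 * (ξ ⬝ᵥ ((I + K) *ᵥ ξ)) + 1 / 2 * ((K *ᵥ u) ⬝ᵥ ((I + K)⁻¹ *ᵥ (I *ᵥ u)))

/-- The reduced Lagrangian `l(Ω_r, ξ)` of the second stage. -/
def lagr2 (I K : Mat3) : Lagr 0 (V3 × V3) := fun _ _ x =>
  1 / 2 * (x.2 ⬝ᵥ ((I + K) *ᵥ x.2)) + 1 / 2 * ((K *ᵥ x.1) ⬝ᵥ ((I + K)⁻¹ *ᵥ (I *ᵥ x.1)))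

/-- The Lie algebra `so(3) ⊕ ℝ³` of the group `SO(3) × T³`, as a Lagrange-Poincare structure over
a point. Its vertical equation is the Euler-Poincare equation. -/
def eulerPoincare : LPStructure 0 (V3 × V3) where
  bracket _ x y := (x.1 ⨯₃ y.1, 0)
  form _ _ _ := 0
  conn _ _ _ := 0

/-- The Euler-Poincare reduced Lagrangian `ℓ(Ω, Ω_r)`. -/
def lagrEP (I K : Mat3) : Lagr 0 (V3 × V3) := fun _ _ x =>
  1 / 2 * (x.1 ⬝ᵥ (I *ᵥ x.1)) + 1 / 2 * ((x.1 + x.2) ⬝ᵥ (K *ᵥ (x.1 + x.2)))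

/-- The quotient of `T(T³) ⊕ (T³ × so(3))` by the action `φ · (θ, θ̇, ξ) = (θ + φ, θ̇, ξ)` of
`T³`. -/
abbrev Stage1modT3 : Type :=
  Quot (fun x y : Torus 3 × V3 × V3 => ∃ φ : Torus 3, y = (x.1 + φ, x.2))

end Rotor

end

/-!
The first reduction rests on the fact that `SO(3)` acts on `so(3) = ℝ³` by `Ad_R v = R v`
(`Ad_apply`), because a rotation preserves the cross product (`SO3.mulVec_cross`). In the
left-invariant frame the mechanical connection is therefore `A = R (Ω + M θ̇)` with
`M = (I + K)⁻¹ K`, and it vanishes exactly where the momentum `(I + K) Ω + K θ̇` conjugate to the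
rotations does (`mechConnection_eq_zero_iff`). On horizontal vectors only the structure constants
of `so(3)` contribute to `dA`, so the curvature is `R (M θ̇₂ × M θ̇₁)`
(`curvature_mechConnection`). Reading the bracket, the curvature and the covariant derivative in the
trivialization by `R⁻¹` gives the explicit structure of the first stage.

The Jacobi identity on sections of `T(T³) ⊕ (T³ × so(3))` is reduced to the one for vector fields.
A section `X ⊕ w` is sent to the vector field `(x, y) ↦ (X(x), (M X - w)(x) × y)` on `ℝ³ × ℝ³`. This
map is injective (`actionField_injective`) and turns the bracket of sections into the Lie bracket
(`lieBracket_actionField`), where the connection term, the curvature term and the fibrewise bracket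
all come from expanding the bracket of the second components. For the second stage the twisted
bracket is the cross product of the body angular velocities `Ω = ξ - M Ω_r`
(`stage2_bracket_eq_cross`), and its Jacobi identity is that of the cross product.

The Lagrangians are quadratic forms, so each Lagrange-Poincare equation, paired with a test
vector, is a scalar identity between triple products; removing the test vector gives the explicit
systems. The reduced rotor inertia `K (I + K)⁻¹ I` that appears in the equations for `Ω_r` equals
`Mᵀ I`, and cancelling the invertible matrix `Mᵀ` leaves `I Ω_r' = -((I + K) ξ) × Ω`.
Finally `(I + K) ξ = (I + K) Ω + K Ω_r`, so the `ξ`-equation is balance of the total angular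
momentum; adding the rotor equation to it gives `(I + K) (Ω + Ω_r)' = 0`, which is conservation
of the rotor momentum (`rotor_eq_iff`).
-/

namespace Rotor

/-! ### Rotations and the cross product -/

/-- The cofactor identity `Aᵀ (A a × A b) = det A (a × b)`. -/
theorem transpose_mulVec_cross (A : Mat3) (a b : V3) :
    Aᵀ *ᵥ ((A *ᵥ a) ⨯₃ (A *ᵥ b)) = A.det • (a ⨯₃ b) := by
  ext i
  fin_cases i <;>
    simp [Matrix.mulVec, dotProduct, Fin.sum_univ_three, cross_apply, Matrix.det_fin_three] <;> ring

theorem SO3.det_eq_one (R : SO3) : (R : Mat3).det = 1 :=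
  (mem_specialOrthogonalGroup_iff.1 R.2).2

@[simp] theorem SO3.coe_inv (R : SO3) : ((R⁻¹ : SO3) : Mat3) = (R : Mat3)ᵀ := by
  have h : ((R⁻¹ : SO3) : Mat3) * (R : Mat3) = 1 := by
    rw [← Submonoid.coe_mul, inv_mul_cancel, Submonoid.coe_one]
  calc ((R⁻¹ : SO3) : Mat3) = ((R⁻¹ : SO3) : Mat3) * ((R : Mat3) * (R : Mat3)ᵀ) := by
        rw [SO3.mul_transpose_self, Matrix.mul_one]
    _ = (R : Mat3)ᵀ := by rw [← Matrix.mul_assoc, h, Matrix.one_mul]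

@[simp] theorem SO3.transpose_mulVec_mulVec (R : SO3) (v : V3) :
    (R : Mat3)ᵀ *ᵥ ((R : Mat3) *ᵥ v) = v := by
  rw [Matrix.mulVec_mulVec, SO3.transpose_mul_self, Matrix.one_mulVec]

@[simp] theorem SO3.mulVec_transpose_mulVec (R : SO3) (v : V3) :
    (R : Mat3) *ᵥ ((R : Mat3)ᵀ *ᵥ v) = v := by
  rw [Matrix.mulVec_mulVec, SO3.mul_transpose_self, Matrix.one_mulVec]

theorem SO3.mulVec_cross (R : SO3) (a b : V3) :
    (R : Mat3) *ᵥ (a ⨯₃ b) = ((R : Mat3) *ᵥ a) ⨯₃ ((R : Mat3) *ᵥ b) := by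
  have h := transpose_mulVec_cross (R : Mat3) a b
  rw [SO3.det_eq_one, one_smul] at h
  rw [← h, SO3.mulVec_transpose_mulVec]

theorem SO3.transpose_mulVec_cross (R : SO3) (a b : V3) :
    (R : Mat3)ᵀ *ᵥ (a ⨯₃ b) = ((R : Mat3)ᵀ *ᵥ a) ⨯₃ ((R : Mat3)ᵀ *ᵥ b) := by
  simpa using SO3.mulVec_cross R⁻¹ a b

theorem hat_mulVec (v w : V3) : hat v *ᵥ w = v ⨯₃ w := by
  ext i
  fin_cases i <;> simp [hat, Matrix.mulVec, dotProduct, Fin.sum_univ_three, cross_apply] <;> ring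

@[simp] theorem vee_hat (v : V3) : vee (hat v) = v := by
  ext i; fin_cases i <;> simp [hat, vee]

theorem hat_vee {S : Mat3} (hS : Sᵀ = -S) : hat (vee S) = S := by
  have h : ∀ i j, S j i = -S i j := fun i j => congrFun (congrFun hS i) j
  have h0 := h 0 0
  have h1 := h 1 1
  have h2 := h 2 2
  ext i j
  fin_cases i <;> fin_cases j <;> simp [hat, vee, ← h] <;> linarith

/-- Equivariance of the identification of `ℝ³` with `so(3)`. -/
theorem hat_mulVec_eq_conj (R : SO3) (v : V3) :
    hat ((R : Mat3) *ᵥ v) = (R : Mat3) * hat v * (R : Mat3)ᵀ := by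
  refine Matrix.mulVec_injective (funext fun w => ?_)
  simp only [← Matrix.mulVec_mulVec, hat_mulVec, SO3.mulVec_cross, SO3.mulVec_transpose_mulVec]

@[simp] theorem Ad_apply (R : SO3) (v : V3) : Ad R v = (R : Mat3) *ᵥ v := by
  change vee ((R : Mat3) * hat v * (R : Mat3)ᵀ) = _
  rw [← hat_mulVec_eq_conj, vee_hat]

/-! ### The left-invariant frame of the tangent bundle of the configuration space -/

theorem hat_bodyVel (q : Q) (v : tangentQ q) :
    (q.1 : Mat3) * hat (bodyVel q v) = v.1.1 := by
  change (q.1 : Mat3) * hat (vee ((q.1 : Mat3)ᵀ * v.1.1)) = _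
  rw [hat_vee v.2, ← Matrix.mul_assoc, SO3.mul_transpose_self, Matrix.one_mul]

@[simp] theorem bodyVel_leftInv (x : V3 × V3) (q : Q) : bodyVel q (leftInv x q) = x.1 := by
  change vee ((q.1 : Mat3)ᵀ * ((q.1 : Mat3) * hat x.1)) = _
  rw [← Matrix.mul_assoc, SO3.transpose_mul_self, Matrix.one_mul, vee_hat]

@[simp] theorem rotorVel_leftInv (x : V3 × V3) (q : Q) : rotorVel q (leftInv x q) = x.2 := rfl

@[simp] theorem leftInv_bodyVel_rotorVel (q : Q) (v : tangentQ q) :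
    leftInv (bodyVel q v, rotorVel q v) q = v :=
  Subtype.ext (Prod.ext (hat_bodyVel q v) rfl)

@[simp] theorem bodyVel_generator (ζ : V3) (q : Q) :
    bodyVel q (generator ζ q) = (q.1 : Mat3)ᵀ *ᵥ ζ := by
  change vee ((q.1 : Mat3)ᵀ * (hat ζ * (q.1 : Mat3))) = _
  have h := hat_mulVec_eq_conj q.1⁻¹ ζ
  rw [SO3.coe_inv, Matrix.transpose_transpose, Matrix.mul_assoc] at h
  rw [← h, vee_hat]

@[simp] theorem rotorVel_generator (ζ : V3) (q : Q) : rotorVel q (generator ζ q) = 0 := rfl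

@[simp] theorem bodyVel_tangentAct (g : SO3) (q : Q) (v : tangentQ q) :
    bodyVel (act g q) (tangentAct g q v) = bodyVel q v := by
  change vee (((g : Mat3) * (q.1 : Mat3))ᵀ * ((g : Mat3) * v.1.1)) = vee ((q.1 : Mat3)ᵀ * v.1.1)
  rw [Matrix.transpose_mul, Matrix.mul_assoc, ← Matrix.mul_assoc _ (g : Mat3) v.1.1,
    SO3.transpose_mul_self, Matrix.one_mul]

@[simp] theorem rotorVel_tangentAct (g : SO3) (q : Q) (v : tangentQ q) :
    rotorVel (act g q) (tangentAct g q v) = rotorVel q v := rfl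

/-- The left-invariant frame trivializes each tangent space of `Q`. -/
def tangentEquiv (q : Q) : tangentQ q ≃ₗ[ℝ] V3 × V3 where
  toFun v := (bodyVel q v, rotorVel q v)
  map_add' v w := by simp
  map_smul' c v := by simp
  invFun x := leftInv x q
  left_inv v := leftInv_bodyVel_rotorVel q v
  right_inv x := by simp

/-! ### The mechanical connection -/

theorem mechConnection_apply (I K : Mat3) (q : Q) (v : tangentQ q) :
    mechConnection I K q v
      = (q.1 : Mat3) *ᵥ (bodyVel q v + ((I + K)⁻¹ * K) *ᵥ rotorVel q v) :=
  Ad_apply _ _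

theorem Ad_inv_mechConnection (I K : Mat3) (q : Q) (v : tangentQ q) :
    Ad q.1⁻¹ (mechConnection I K q v)
      = bodyVel q v + ((I + K)⁻¹ * K) *ᵥ rotorVel q v := by
  rw [mechConnection_apply, Ad_apply, SO3.coe_inv, SO3.transpose_mulVec_mulVec]

theorem mechConnection_generator (I K : Mat3) (q : Q) (ζ : V3) :
    mechConnection I K q (generator ζ q) = ζ := by
  simp [mechConnection_apply, SO3.mul_transpose_self]

theorem mechConnection_tangentAct (I K : Mat3) (g : SO3) (q : Q) (v : tangentQ q) :
    mechConnection I K (act g q) (tangentAct g q v) = Ad g (mechConnection I K q v) := by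
  rw [Ad_apply, mechConnection_apply, mechConnection_apply, bodyVel_tangentAct,
    rotorVel_tangentAct, Matrix.mulVec_mulVec]
  rfl

/-- The isomorphism `(Ω, θ̇) ↦ (θ̇, Ω + M θ̇)` of a tangent space of `Q` with `ℝ³ ⊕ so(3)`. -/
def shearEquiv (M : Mat3) : (V3 × V3) ≃ₗ[ℝ] V3 × V3 where
  toFun x := (x.2, x.1 + M *ᵥ x.2)
  map_add' x y := by
    simp only [Prod.fst_add, Prod.snd_add, Matrix.mulVec_add, Prod.mk_add_mk]
    rw [add_add_add_comm]
  map_smul' c x := by simp [Matrix.mulVec_smul]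
  invFun y := (y.2 - M *ᵥ y.1, y.1)
  left_inv x := by simp
  right_inv y := by simp

theorem exists_tangentQ_equiv (I K : Mat3) (q : Q) :
    ∃ e : tangentQ q ≃ₗ[ℝ] V3 × V3, ∀ v,
      e v = (rotorVel q v, Ad q.1⁻¹ (mechConnection I K q v)) := by
  refine ⟨(tangentEquiv q).trans (shearEquiv ((I + K)⁻¹ * K)), fun v => ?_⟩
  rw [Ad_inv_mechConnection]
  rfl

theorem TQ_ext {x y : TQ} (hq : x.1 = y.1) (h₁ : x.2.1.1 = y.2.1.1) (h₂ : x.2.1.2 = y.2.1.2) :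
    x = y := by
  obtain ⟨q, v⟩ := x
  obtain ⟨p, w⟩ := y
  obtain rfl : q = p := hq
  exact congrArg (Sigma.mk q) (Subtype.ext (Prod.ext h₁ h₂))

/-- The map `[q, v] ↦ (θ, θ̇, Ad_{R⁻¹} A(v))`. Every orbit of `SO(3)` meets the fibre over the
identity rotation exactly once, which gives the inverse. -/
theorem exists_TQmodSO3_equiv (I K : Mat3) :
    ∃ e : TQmodSO3 ≃ Torus 3 × V3 × V3, ∀ q v,
      e (Quot.mk _ ⟨q, v⟩) = (q.2, rotorVel q v, Ad q.1⁻¹ (mechConnection I K q v)) := by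
  let M := (I + K)⁻¹ * K
  refine ⟨{
    toFun := Quot.lift
      (fun x => (x.1.2, rotorVel x.1 x.2, bodyVel x.1 x.2 + M *ᵥ rotorVel x.1 x.2)) ?_
    invFun := fun y => Quot.mk _ ⟨(1, y.1), leftInv (y.2.2 - M *ᵥ y.2.1, y.2.1) (1, y.1)⟩
    left_inv := ?_
    right_inv := ?_ }, fun q v => ?_⟩
  · rintro ⟨q, v⟩ _ ⟨g, rfl⟩
    simp only [bodyVel_tangentAct, rotorVel_tangentAct]
    rfl
  · rintro ⟨q, v⟩
    refine Quot.sound ⟨q.1, TQ_ext (Prod.ext (mul_one q.1).symm rfl) (Eq.symm ?_) rfl⟩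
    change (q.1 : Mat3) * ((1 : Mat3) * hat (bodyVel q v + M *ᵥ rotorVel q v - M *ᵥ rotorVel q v))
      = v.1.1
    rw [Matrix.one_mul, add_sub_cancel_right, hat_bodyVel]
  · rintro ⟨θ, u, ξ⟩
    simp
  · exact congrArg (fun ξ => (q.2, rotorVel q v, ξ)) (Ad_inv_mechConnection I K q v).symm

/-- The trivialization `[q, ζ] ↦ (θ, Ad_{R⁻¹} ζ)` of the adjoint bundle. -/
def adjointEquiv : AdjointBundle ≃ Torus 3 × V3 where
  toFun := Quot.lift (fun x : Q × V3 => (x.1.2, Ad x.1.1⁻¹ x.2)) (by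
    rintro ⟨q, ζ⟩ _ ⟨g, rfl⟩
    simp only [act, Ad_apply, SO3.coe_inv, Submonoid.coe_mul, Matrix.transpose_mul,
      ← Matrix.mulVec_mulVec, SO3.transpose_mulVec_mulVec])
  invFun y := adjMk (1, y.1) y.2
  left_inv := by
    rintro ⟨q, ζ⟩
    refine Quot.sound ⟨q.1, ?_⟩
    simp only [act, Ad_apply, SO3.coe_inv, mul_one, SO3.mulVec_transpose_mulVec]
  right_inv := by
    rintro ⟨θ, α⟩
    change (θ, Ad (1 : SO3)⁻¹ α) = _
    simp

theorem adjointEquiv_adjMk (q : Q) (ζ : V3) :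
    adjointEquiv (adjMk q ζ) = (q.2, (q.1 : Mat3)ᵀ *ᵥ ζ) := by
  change (q.2, Ad q.1⁻¹ ζ) = _
  rw [Ad_apply, SO3.coe_inv]

/-- `T³` acts transitively on the base and trivially on the fibres. -/
theorem exists_Stage1modT3_equiv :
    ∃ e : Stage1modT3 ≃ V3 × V3, ∀ θ u ξ, e (Quot.mk _ (θ, u, ξ)) = (u, ξ) := by
  refine ⟨{
    toFun := Quot.lift (fun x => x.2) ?_
    invFun := fun y => Quot.mk _ (0, y)
    left_inv := ?_
    right_inv := fun y => rfl }, fun θ u ξ => rfl⟩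
  · rintro x _ ⟨φ, rfl⟩
    rfl
  · rintro ⟨θ, y⟩
    exact Quot.sound ⟨θ, by rw [zero_add]⟩


/-! ### Derivatives along left-invariant fields and curvature -/

/-- `hat` as a linear map. -/
def hatLin : V3 →ₗ[ℝ] Mat3 where
  toFun := hat
  map_add' := hat_add
  map_smul' := hat_smul

open scoped Matrix.Norms.Operator in
theorem contDiff_expSO3_mulVec (w : V3) :
    ContDiff ℝ ∞ (fun z : V3 => (expSO3 z : Mat3) *ᵥ w) := by
  have h₁ : ContDiff ℝ ∞ (fun z : V3 => hat z) :=
    (LinearMap.toContinuousLinearMap hatLin).contDiff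
  have h₂ : ContDiff ℝ ∞ (NormedSpace.exp : Mat3 → Mat3) := by
    rw [contDiff_iff_contDiffAt]
    exact fun x => (NormedSpace.exp_analytic (𝕂 := ℝ) x).contDiffAt
  exact (LinearMap.toContinuousLinearMap ((Matrix.mulVecBilin ℝ ℝ).flip w)).contDiff.comp
    (h₂.comp h₁)

open scoped Matrix.Norms.Operator in
theorem hasDerivAt_expSO3_smul_mulVec (x w : V3) :
    HasDerivAt (fun s : ℝ => (expSO3 (s • x) : Mat3) *ᵥ w) (x ⨯₃ w) 0 := by
  have h₀ := hasDerivAt_exp_smul_const (𝕂 := ℝ) (hat x) 0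
  rw [zero_smul, NormedSpace.exp_zero, Matrix.one_mul] at h₀
  have h₁ := (LinearMap.toContinuousLinearMap
    ((Matrix.mulVecBilin ℝ ℝ).flip w)).hasFDerivAt.comp_hasDerivAt (0 : ℝ) h₀
  rw [← hat_mulVec]
  simp only [expSO3, hat_smul]
  exact h₁

theorem mulVec_contDiff {E : Type*} [NormedAddCommGroup E] [NormedSpace ℝ E] (A : Mat3)
    {f : E → V3} (hf : ContDiff ℝ ∞ f) : ContDiff ℝ ∞ (fun x => A *ᵥ f x) :=
  (LinearMap.toContinuousLinearMap (Matrix.mulVecLin A)).contDiff.comp hf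

theorem hasDerivAt_mulVec (A : Mat3) {f : ℝ → V3} {f' : V3} {t : ℝ} (hf : HasDerivAt f f' t) :
    HasDerivAt (fun s => A *ᵥ f s) (A *ᵥ f') t :=
  (LinearMap.toContinuousLinearMap (Matrix.mulVecLin A)).hasFDerivAt.comp_hasDerivAt t hf

theorem mechConnection_leftFlow (I K : Mat3) (x y : V3 × V3) (s : ℝ) (q : Q) :
    mechConnection I K (leftFlow x s q) (leftInv y (leftFlow x s q))
      = (q.1 : Mat3) *ᵥ ((expSO3 (s • x.1) : Mat3) *ᵥ (y.1 + ((I + K)⁻¹ * K) *ᵥ y.2)) := by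
  rw [mechConnection_apply, bodyVel_leftInv, rotorVel_leftInv, Matrix.mulVec_mulVec]
  rfl

theorem isPrincipalConnection_mechConnection (I K : Mat3) :
    IsPrincipalConnection (mechConnection I K) := by
  refine ⟨mechConnection_generator I K, mechConnection_tangentAct I K, fun x q => ?_⟩
  have h : (fun z : V3 × V3 => mechConnection I K (leftFlow z 1 q) (leftInv x (leftFlow z 1 q)))
      = fun z : V3 × V3 =>
        (q.1 : Mat3) *ᵥ ((expSO3 z.1 : Mat3) *ᵥ (x.1 + ((I + K)⁻¹ * K) *ᵥ x.2)) := by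
    funext z
    rw [mechConnection_leftFlow, one_smul]
  rw [h]
  exact mulVec_contDiff _ ((contDiff_expSO3_mulVec _).comp contDiff_fst)

theorem deriv_mechConnection_leftFlow (I K : Mat3) (x y : V3 × V3) (q : Q) :
    deriv (fun s : ℝ => mechConnection I K (leftFlow x s q) (leftInv y (leftFlow x s q))) 0
      = (q.1 : Mat3) *ᵥ (x.1 ⨯₃ (y.1 + ((I + K)⁻¹ * K) *ᵥ y.2)) := by
  simp only [mechConnection_leftFlow]
  exact (hasDerivAt_mulVec _ (hasDerivAt_expSO3_smul_mulVec _ _)).deriv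

theorem bodyVel_horProj (I K : Mat3) (q : Q) (v : tangentQ q) :
    bodyVel q (horProj (mechConnection I K) q v) = -(((I + K)⁻¹ * K) *ᵥ rotorVel q v) := by
  rw [horProj, map_sub, bodyVel_generator, mechConnection_apply, SO3.transpose_mulVec_mulVec,
    sub_add_cancel_left]

theorem rotorVel_horProj (A : OneForm) (q : Q) (v : tangentQ q) :
    rotorVel q (horProj A q v) = rotorVel q v := by
  rw [horProj, map_sub, rotorVel_generator, sub_zero]

/-- On horizontal vectors only the term `-A([X, Y])` of `dA(X, Y)` survives: the connection
vanishes identically on the left-invariant extension of a horizontal vector. -/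
theorem curvature_mechConnection (I K : Mat3) (q : Q) (v w : tangentQ q) :
    curvature (mechConnection I K) q v w
      = (q.1 : Mat3) *ᵥ ((((I + K)⁻¹ * K) *ᵥ rotorVel q w) ⨯₃
          (((I + K)⁻¹ * K) *ᵥ rotorVel q v)) := by
  simp only [curvature, extDerivForm, deriv_mechConnection_leftFlow, bodyVel_horProj,
    rotorVel_horProj]
  simp only [mechConnection_apply, bodyVel_leftInv, rotorVel_leftInv, neg_add_cancel,
    map_zero, Matrix.mulVec_zero, sub_zero, zero_sub, add_zero,
    map_neg, LinearMap.neg_apply, neg_neg]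
  rw [← Matrix.mulVec_neg, cross_anticomm]

theorem rotorVel_horLift (A : OneForm) (q : Q) (X : V3) : rotorVel q (horLift A q X) = X :=
  rotorVel_horProj A q _

theorem curvature_horLift (I K : Mat3) (q : Q) (X Y : V3) :
    curvature (mechConnection I K) q (horLift (mechConnection I K) q X)
        (horLift (mechConnection I K) q Y)
      = (q.1 : Mat3) *ᵥ ((((I + K)⁻¹ * K) *ᵥ Y) ⨯₃ (((I + K)⁻¹ * K) *ᵥ X)) := by
  rw [curvature_mechConnection, rotorVel_horLift, rotorVel_horLift]

/-! ### The reduced bundle of the first stage -/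

theorem stage1_bracket (I K : Mat3) (θ : Torus 3) (α β : V3) :
    (stage1 I K).bracket θ α β = α ⨯₃ β := rfl

theorem stage1_conn (I K : Mat3) (θ : Torus 3) (u α : V3) :
    (stage1 I K).conn θ u α = -((((I + K)⁻¹ * K) *ᵥ u) ⨯₃ α) := by
  change -(mechConnection I K (1, θ) (leftInv (0, u) (1, θ)) ⨯₃ α) = _
  rw [mechConnection_apply, bodyVel_leftInv, rotorVel_leftInv, zero_add]
  simp

theorem stage1_form (I K : Mat3) (θ : Torus 3) (X Y : V3) :
    (stage1 I K).form θ X Y = (((I + K)⁻¹ * K) *ᵥ Y) ⨯₃ (((I + K)⁻¹ * K) *ᵥ X) := by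
  refine (curvature_horLift I K (1, θ) X Y).trans ?_
  simp

/-- Since `M = (I + K)⁻¹ K` is invertible, two vectors can be chosen whose images under `M` have
a nonzero cross product. -/
theorem exists_stage1_form_ne_zero {I K : Mat3} (hI : I.PosDef) (hK : K.PosDef) (θ : Torus 3) :
    ∃ X Y, (stage1 I K).form θ X Y ≠ 0 := by
  have hM : IsUnit ((I + K)⁻¹ * K) :=
    (Matrix.isUnit_nonsing_inv_iff.2 (hI.add hK).isUnit).mul hK.isUnit
  obtain ⟨X, hX⟩ := Matrix.mulVec_surjective_iff_isUnit.2 hM ![1, 0, 0]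
  obtain ⟨Y, hY⟩ := Matrix.mulVec_surjective_iff_isUnit.2 hM ![0, 1, 0]
  refine ⟨X, Y, fun h => ?_⟩
  rw [stage1_form, hX, hY] at h
  have h₂ := congrFun h 2
  simp [cross_apply] at h₂

/-- The covariant derivative of the adjoint bundle in the trivialization: the derivative of
`R⁻¹ ζ` contributes `-Ω × α`, which together with `-(M θ̇) × α` is the image of `-A(q̇) × ζ`. -/
theorem adjointEquiv_covDeriv (I K : Mat3) (q : ℝ → Q) (v : ∀ s, tangentQ (q s)) (ζ : ℝ → V3)
    (t : ℝ) (hq : HasVelocityAt q t (v t)) (hζ : DifferentiableAt ℝ ζ t) :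
    (adjointEquiv (adjMk (q t) (deriv ζ t - mechConnection I K (q t) (v t) ⨯₃ ζ t))).2
      = (stage1 I K).covDeriv (fun s => (q s).2) (fun s => rotorVel (q s) (v s))
          (fun s => (adjointEquiv (adjMk (q s) (ζ s))).2) t := by
  have hder : HasDerivAt (fun s => ((q s).1 : Mat3)ᵀ *ᵥ ζ s)
      ((v t).1.1ᵀ *ᵥ ζ t + ((q t).1 : Mat3)ᵀ *ᵥ deriv ζ t) t := by
    rw [hasDerivAt_pi]
    intro i
    have h := HasDerivAt.fun_sum (u := Finset.univ) (fun j _ =>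
      (hq.1 j i).mul ((hasDerivAt_pi.1 hζ.hasDerivAt) j))
    simpa [Matrix.mulVec, dotProduct, Finset.sum_add_distrib] using h
  have hv : (v t).1.1ᵀ *ᵥ ζ t
      = -(bodyVel (q t) (v t) ⨯₃ (((q t).1 : Mat3)ᵀ *ᵥ ζ t)) := by
    rw [← hat_bodyVel, Matrix.transpose_mul, hat_transpose, ← Matrix.mulVec_mulVec,
      Matrix.neg_mulVec, hat_mulVec]
  simp only [LPStructure.covDeriv, adjointEquiv_adjMk, stage1_conn]
  rw [hder.deriv, hv, mechConnection_apply, Matrix.mulVec_sub, SO3.transpose_mulVec_cross,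
    SO3.transpose_mulVec_mulVec, map_add, LinearMap.add_apply]
  abel


/-! ### Smooth functions on the torus -/

section Torus

variable {n : ℕ} {E : Type*} [NormedAddCommGroup E] [NormedSpace ℝ E]

theorem toTorus_add (x y : Fin n → ℝ) : toTorus (x + y) = toTorus x + toTorus y :=
  funext fun i => Real.Angle.coe_add (x i) (y i)

theorem toTorus_surjective : Function.Surjective (toTorus (n := n)) := fun θ => by
  choose x hx using fun i => QuotientAddGroup.mk_surjective (θ i)
  exact ⟨x, funext hx⟩

theorem TorusSmooth.contDiff {f : Torus n → E} (hf : TorusSmooth f) :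
    ContDiff ℝ ∞ fun x => f (toTorus x) := hf

theorem TorusSmooth.neg {f : Torus n → E} (hf : TorusSmooth f) : TorusSmooth (fun θ => -f θ) :=
  ContDiff.neg hf

theorem TorusSmooth.differentiable {f : Torus n → E} (hf : TorusSmooth f) :
    Differentiable ℝ fun x => f (toTorus x) :=
  ContDiff.differentiable hf (by simp)

theorem TorusSmooth.const (c : E) : TorusSmooth (fun _ : Torus n => c) := contDiff_const

theorem TorusSmooth.sub {f g : Torus n → E} (hf : TorusSmooth f) (hg : TorusSmooth g) :
    TorusSmooth (fun θ => f θ - g θ) := ContDiff.sub hf hg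

theorem TorusSmooth.add {f g : Torus n → E} (hf : TorusSmooth f) (hg : TorusSmooth g) :
    TorusSmooth (fun θ => f θ + g θ) := ContDiff.add hf hg

theorem dirDeriv_toTorus {f : Torus n → E} (hf : TorusSmooth f) (x X : Fin n → ℝ) :
    dirDeriv f (toTorus x) X = fderiv ℝ (fun y => f (toTorus y)) x X := by
  have h := (hf.differentiable x).hasFDerivAt.hasLineDerivAt X
  simp only [dirDeriv, ← toTorus_add]
  exact h.lineDeriv

theorem TorusSmooth.dirDeriv {f : Torus n → E} {X : Torus n → Fin n → ℝ} (hf : TorusSmooth f)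
    (hX : TorusSmooth X) : TorusSmooth (fun θ => dirDeriv f θ (X θ)) := by
  simp only [TorusSmooth, dirDeriv_toTorus hf]
  exact (ContDiff.fderiv_right (m := ∞) hf (by simp)).clm_apply hX

end Torus

/-! ### The bracket laws of the reduced bundles -/

/-- The cross product as a continuous bilinear map. -/
noncomputable def crossCLM : V3 →L[ℝ] V3 →L[ℝ] V3 := LinearMap.toContinuousBilinearMap crossProduct

theorem cross_contDiff {E : Type*} [NormedAddCommGroup E] [NormedSpace ℝ E] {f g : E → V3}
    (hf : ContDiff ℝ ∞ f) (hg : ContDiff ℝ ∞ g) : ContDiff ℝ ∞ (fun x => f x ⨯₃ g x) :=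
  (crossCLM.contDiff.comp hf).clm_apply hg

theorem cross_jacobi_left (u v w : V3) :
    (u ⨯₃ v) ⨯₃ w + (v ⨯₃ w) ⨯₃ u + (w ⨯₃ u) ⨯₃ v = 0 := by
  rw [← cross_anticomm w (u ⨯₃ v), ← cross_anticomm u (v ⨯₃ w),
    ← cross_anticomm v (w ⨯₃ u), ← neg_add, ← neg_add,
    neg_eq_zero, ← jacobi_cross u v w]
  abel

/-- The vector field `(x, y) ↦ (X(x), (M X - w)(x) × y)` on `ℝ³ × ℝ³` attached to a section
`X ⊕ w` of `T(T³) ⊕ (T³ × so(3))`. -/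
noncomputable def actionField (M : Mat3) (x : (Torus 3 → Fin 3 → ℝ) × (Torus 3 → V3))
    (p : V3 × V3) : V3 × V3 :=
  (x.1 (toTorus p.1), (M *ᵥ x.1 (toTorus p.1) - x.2 (toTorus p.1)) ⨯₃ p.2)

theorem actionField_contDiff (M : Mat3) {x : (Torus 3 → Fin 3 → ℝ) × (Torus 3 → V3)}
    (h₁ : TorusSmooth x.1) (h₂ : TorusSmooth x.2) : ContDiff ℝ ∞ (actionField M x) := by
  have h₁' : ContDiff ℝ ∞ fun p : V3 × V3 => x.1 (toTorus p.1) := h₁.contDiff.comp contDiff_fst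
  have h₂' : ContDiff ℝ ∞ fun p : V3 × V3 => x.2 (toTorus p.1) := h₂.contDiff.comp contDiff_fst
  exact h₁'.prodMk (cross_contDiff ((mulVec_contDiff M h₁').sub h₂') contDiff_snd)

theorem actionField_add (M : Mat3) (x y : (Torus 3 → Fin 3 → ℝ) × (Torus 3 → V3)) :
    actionField M (x + y) = actionField M x + actionField M y := by
  funext p
  refine Prod.ext rfl ?_
  simp only [actionField, Prod.fst_add, Prod.snd_add, Pi.add_apply, Matrix.mulVec_add,
    ← LinearMap.add_apply, ← map_add]
  congr 2
  abel

theorem cross_left_injective {a b : V3} (h : ∀ y, a ⨯₃ y = b ⨯₃ y) : a = b := by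
  have h₀ := h ![1, 0, 0]
  have h₁ := h ![0, 1, 0]
  have e₀ := congrFun h₀ 1
  have e₁ := congrFun h₀ 2
  have e₂ := congrFun h₁ 2
  simp [cross_apply] at e₀ e₁ e₂
  ext i
  fin_cases i <;> simp_all

/-- A section can be recovered from its vector field, since `so(3)` acts faithfully on `ℝ³`. -/
theorem actionField_injective (M : Mat3) : Function.Injective (actionField M) := by
  intro x y h
  have key : ∀ θ, x.1 θ = y.1 θ ∧ x.2 θ = y.2 θ := by
    intro θ
    obtain ⟨a, rfl⟩ := toTorus_surjective θ
    have h₁ : x.1 (toTorus a) = y.1 (toTorus a) := congrArg Prod.fst (congrFun h (a, 0))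
    refine ⟨h₁, ?_⟩
    have h₂ : M *ᵥ x.1 (toTorus a) - x.2 (toTorus a) = M *ᵥ y.1 (toTorus a) - y.2 (toTorus a) :=
      cross_left_injective fun b => congrArg Prod.snd (congrFun h (a, b))
    rwa [h₁, sub_right_inj] at h₂
  exact Prod.ext (funext fun θ => (key θ).1) (funext fun θ => (key θ).2)

theorem fderiv_actionField (M : Mat3) {x : (Torus 3 → Fin 3 → ℝ) × (Torus 3 → V3)}
    (h₁ : TorusSmooth x.1) (h₂ : TorusSmooth x.2) (p u : V3 × V3) :
    fderiv ℝ (actionField M x) p u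
      = (dirDeriv x.1 (toTorus p.1) u.1,
          (M *ᵥ x.1 (toTorus p.1) - x.2 (toTorus p.1)) ⨯₃ u.2
            + (M *ᵥ dirDeriv x.1 (toTorus p.1) u.1 - dirDeriv x.2 (toTorus p.1) u.1) ⨯₃ p.2) := by
  have d₁ : HasFDerivAt (fun p : V3 × V3 => x.1 (toTorus p.1))
      ((fderiv ℝ (fun a => x.1 (toTorus a)) p.1).comp (ContinuousLinearMap.fst ℝ V3 V3)) p :=
    (h₁.differentiable p.1).hasFDerivAt.comp p hasFDerivAt_fst
  have d₂ : HasFDerivAt (fun p : V3 × V3 => x.2 (toTorus p.1))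
      ((fderiv ℝ (fun a => x.2 (toTorus a)) p.1).comp (ContinuousLinearMap.fst ℝ V3 V3)) p :=
    (h₂.differentiable p.1).hasFDerivAt.comp p hasFDerivAt_fst
  have d₃ := ((LinearMap.toContinuousLinearMap (Matrix.mulVecLin M)).hasFDerivAt.comp p d₁).sub d₂
  have d₄ := d₁.prodMk (crossCLM.hasFDerivAt_of_bilinear d₃ hasFDerivAt_snd)
  rw [dirDeriv_toTorus h₁, dirDeriv_toTorus h₂]
  exact congrArg (fun T => T u) (HasFDerivAt.fderiv (f := actionField M x) d₄)

/-- Brackets of smooth sections are smooth, so that the Jacobi identity may be transported. -/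
theorem stage1_sectionBracket_smooth (I K : Mat3)
    {x y : (Torus 3 → Fin 3 → ℝ) × (Torus 3 → V3)}
    (hx₁ : TorusSmooth x.1) (hx₂ : TorusSmooth x.2) (hy₁ : TorusSmooth y.1)
    (hy₂ : TorusSmooth y.2) :
    TorusSmooth ((stage1 I K).sectionBracket x y).1 ∧
      TorusSmooth ((stage1 I K).sectionBracket x y).2 := by
  refine ⟨(hy₁.dirDeriv hx₁).sub (hx₁.dirDeriv hy₁), ?_⟩
  simp only [LPStructure.sectionBracket, LPStructure.nabla, stage1_conn, stage1_form,
    stage1_bracket]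
  have hM : ∀ {X : Torus 3 → V3}, TorusSmooth X → TorusSmooth fun θ => ((I + K)⁻¹ * K) *ᵥ X θ :=
    fun h => mulVec_contDiff _ h
  have hc : ∀ {X Y : Torus 3 → V3}, TorusSmooth X → TorusSmooth Y →
      TorusSmooth fun θ => X θ ⨯₃ Y θ := fun h h' => cross_contDiff h h'
  exact ((((hy₂.dirDeriv hx₁).add ((hc (hM hx₁) hy₂).neg)).sub
    ((hx₂.dirDeriv hy₁).add ((hc (hM hy₁) hx₂).neg))).sub
      (hc (hM hy₁) (hM hx₁))).add (hc hx₂ hy₂)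

/-- `X ⊕ w ↦ actionField M (X ⊕ w)` is a homomorphism from the bracket of sections to the bracket
of vector fields. -/
theorem lieBracket_actionField (I K : Mat3) {x y : (Torus 3 → Fin 3 → ℝ) × (Torus 3 → V3)}
    (hx₁ : TorusSmooth x.1) (hx₂ : TorusSmooth x.2) (hy₁ : TorusSmooth y.1)
    (hy₂ : TorusSmooth y.2) :
    VectorField.lieBracket ℝ (actionField ((I + K)⁻¹ * K) x) (actionField ((I + K)⁻¹ * K) y)
      = actionField ((I + K)⁻¹ * K) ((stage1 I K).sectionBracket x y) := by
  funext p
  rw [VectorField.lieBracket, fderiv_actionField _ hx₁ hx₂, fderiv_actionField _ hy₁ hy₂]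
  refine Prod.ext rfl ?_
  simp only [actionField, LPStructure.sectionBracket, LPStructure.nabla, stage1_conn,
    stage1_form, stage1_bracket, Prod.snd_sub, Matrix.mulVec_sub]
  generalize ((I + K)⁻¹ * K) *ᵥ x.1 (toTorus p.1) = MX
  generalize ((I + K)⁻¹ * K) *ᵥ y.1 (toTorus p.1) = MY
  simp only [map_sub, map_add, map_neg, LinearMap.sub_apply, LinearMap.add_apply,
    LinearMap.neg_apply, cross_cross]
  abel

theorem lieBracket_jacobi {E : Type*} [NormedAddCommGroup E] [NormedSpace ℝ E] {U V W : E → E}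
    (hU : ContDiff ℝ ∞ U) (hV : ContDiff ℝ ∞ V) (hW : ContDiff ℝ ∞ W) :
    VectorField.lieBracket ℝ (VectorField.lieBracket ℝ U V) W
      + VectorField.lieBracket ℝ (VectorField.lieBracket ℝ V W) U
      + VectorField.lieBracket ℝ (VectorField.lieBracket ℝ W U) V = 0 := by
  funext p
  have h2 : minSmoothness ℝ 2 ≤ (∞ : WithTop ℕ∞) := by
    rw [minSmoothness_of_isRCLikeNormedField]
    exact WithTop.coe_le_coe.2 (le_top : (2 : ℕ∞) ≤ ⊤)
  have jac := VectorField.leibniz_identity_lieBracket h2 (x := p) hU.contDiffAt hV.contDiffAt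
    hW.contDiffAt
  have hneg : VectorField.lieBracket ℝ U W = -VectorField.lieBracket ℝ W U :=
    funext fun _ => VectorField.lieBracket_swap
  have hneg' : VectorField.lieBracket ℝ V (-VectorField.lieBracket ℝ W U) p
      = VectorField.lieBracket ℝ (VectorField.lieBracket ℝ W U) V p := by
    simp only [VectorField.lieBracket_eq (V := V) (W := -_), VectorField.lieBracket_eq (W := V),
      fderiv_neg, Pi.neg_apply, map_neg, _root_.neg_apply]
    abel
  rw [hneg, hneg', VectorField.lieBracket_swap (V := U) (W := VectorField.lieBracket ℝ V W)] at jac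
  simp only [Pi.add_apply, Pi.zero_apply]
  rw [add_right_comm, ← jac, neg_add_cancel]

theorem stage1_isLP (I K : Mat3) : (stage1 I K).IsLP where
  bracket_bilin _ := ⟨crossProduct, fun _ _ => rfl⟩
  bracket_self _ v := cross_self v
  bracket_jacobi θ v w z := cross_jacobi_left v w z
  bracket_smooth _ _ := TorusSmooth.const _
  form_bilin θ := by
    refine ⟨(crossProduct.compl₁₂ (Matrix.mulVecLin ((I + K)⁻¹ * K))
      (Matrix.mulVecLin ((I + K)⁻¹ * K))).flip, fun X Y => ?_⟩
    rw [stage1_form]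
    rfl
  form_self θ X := by rw [stage1_form, cross_self]
  form_smooth X Y := by
    simp only [stage1_form]
    exact TorusSmooth.const _
  conn_bilin θ := by
    refine ⟨-(crossProduct.comp (Matrix.mulVecLin ((I + K)⁻¹ * K))), fun X v => ?_⟩
    rw [stage1_conn]
    rfl
  conn_smooth X v := by
    simp only [stage1_conn]
    exact TorusSmooth.const _
  section_jacobi x y z hx₁ hx₂ hy₁ hy₂ hz₁ hz₂ := by
    have hxy := stage1_sectionBracket_smooth I K hx₁ hx₂ hy₁ hy₂
    have hyz := stage1_sectionBracket_smooth I K hy₁ hy₂ hz₁ hz₂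
    have hzx := stage1_sectionBracket_smooth I K hz₁ hz₂ hx₁ hx₂
    refine actionField_injective ((I + K)⁻¹ * K) ?_
    rw [actionField_add, actionField_add, ← lieBracket_actionField I K hxy.1 hxy.2 hz₁ hz₂,
      ← lieBracket_actionField I K hyz.1 hyz.2 hx₁ hx₂,
      ← lieBracket_actionField I K hzx.1 hzx.2 hy₁ hy₂,
      ← lieBracket_actionField I K hx₁ hx₂ hy₁ hy₂, ← lieBracket_actionField I K hy₁ hy₂ hz₁ hz₂,
      ← lieBracket_actionField I K hz₁ hz₂ hx₁ hx₂]
    rw [lieBracket_jacobi (actionField_contDiff _ hx₁ hx₂) (actionField_contDiff _ hy₁ hy₂)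
      (actionField_contDiff _ hz₁ hz₂)]
    exact funext fun p => Prod.ext rfl (by simp [actionField])

theorem dirDeriv_const {n : ℕ} {E : Type*} [NormedAddCommGroup E] [NormedSpace ℝ E] (c : E)
    (θ : Torus n) (X : Fin n → ℝ) : dirDeriv (fun _ => c) θ X = 0 :=
  deriv_const 0 c

theorem dirDeriv_zero {n : ℕ} {E : Type*} [NormedAddCommGroup E] [NormedSpace ℝ E]
    (f : Torus n → E) (θ : Torus n) : dirDeriv f θ 0 = 0 := by
  simp only [dirDeriv, smul_zero]
  exact deriv_const 0 _

theorem stage2_conn (I K : Mat3) (p : Torus 0) (X : Fin 0 → ℝ) (x : V3 × V3) :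
    (stage2 I K).conn p X x = 0 := by
  change (0, (stage1 I K).conn 0 0 x.2 - (stage1 I K).form 0 0 x.1) = ((0, 0) : V3 × V3)
  simp [stage1_conn, stage1_form]

theorem stage2_form (I K : Mat3) (p : Torus 0) (X Y : Fin 0 → ℝ) :
    (stage2 I K).form p X Y = 0 := by
  change (0, (stage1 I K).form 0 0 0) = ((0, 0) : V3 × V3)
  simp [stage1_form]

theorem stage2_bracket (I K : Mat3) (p : Torus 0) (a₁ ξ₁ a₂ ξ₂ : V3) :
    (stage2 I K).bracket p (a₁, ξ₁) (a₂, ξ₂)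
      = (0, -((((I + K)⁻¹ * K) *ᵥ a₁) ⨯₃ ξ₂) + (((I + K)⁻¹ * K) *ᵥ a₂) ⨯₃ ξ₁
          - (((I + K)⁻¹ * K) *ᵥ a₂) ⨯₃ (((I + K)⁻¹ * K) *ᵥ a₁) + ξ₁ ⨯₃ ξ₂) := by
  refine Prod.ext rfl ?_
  simp only [stage2, LPStructure.torusQuotient, LPStructure.nabla, dirDeriv_const, stage1_conn,
    stage1_form, stage1_bracket]
  abel

/-- In terms of the body angular velocities `Ω = ξ - M Ω_r` the twisted bracket is the cross
product. -/
theorem stage2_bracket_eq_cross (I K : Mat3) (p : Torus 0) (x y : V3 × V3) :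
    (stage2 I K).bracket p x y
      = (0, (x.2 - ((I + K)⁻¹ * K) *ᵥ x.1) ⨯₃ (y.2 - ((I + K)⁻¹ * K) *ᵥ y.1)) := by
  refine (stage2_bracket I K p x.1 x.2 y.1 y.2).trans (Prod.ext rfl ?_)
  simp only [map_sub, LinearMap.sub_apply]
  rw [← cross_anticomm x.2, ← cross_anticomm (((I + K)⁻¹ * K) *ᵥ x.1)]
  abel

theorem stage2_jacobi (I K : Mat3) (p : Torus 0) (v w z : V3 × V3) :
    (stage2 I K).bracket p ((stage2 I K).bracket p v w) z
      + (stage2 I K).bracket p ((stage2 I K).bracket p w z) v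
      + (stage2 I K).bracket p ((stage2 I K).bracket p z v) w = 0 := by
  simp only [stage2_bracket_eq_cross, Matrix.mulVec_zero, sub_zero, Prod.mk_add_mk, add_zero,
    cross_jacobi_left, Prod.mk_zero_zero]

/-- Over a point all derivatives vanish and the bracket of sections is the fibrewise one. -/
theorem stage2_sectionBracket (I K : Mat3)
    (x y : (Torus 0 → Fin 0 → ℝ) × (Torus 0 → V3 × V3)) :
    (stage2 I K).sectionBracket x y
      = (0, fun p => (stage2 I K).bracket p (x.2 p) (y.2 p)) := by
  refine Prod.ext (Subsingleton.elim _ _) (funext fun p => ?_)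
  simp only [LPStructure.sectionBracket, LPStructure.nabla, stage2_conn, stage2_form,
    Subsingleton.elim (x.1 p) 0, Subsingleton.elim (y.1 p) 0, dirDeriv_zero, add_zero, sub_zero,
    zero_add]

theorem stage2_isLP (I K : Mat3) : (stage2 I K).IsLP where
  bracket_bilin p := by
    refine ⟨(crossProduct.compl₁₂
      (LinearMap.snd ℝ V3 V3 - (Matrix.mulVecLin ((I + K)⁻¹ * K)).comp (LinearMap.fst ℝ V3 V3))
      (LinearMap.snd ℝ V3 V3 - (Matrix.mulVecLin ((I + K)⁻¹ * K)).comp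
        (LinearMap.fst ℝ V3 V3))).compr₂ (LinearMap.inr ℝ V3 V3), fun v w => ?_⟩
    rw [stage2_bracket_eq_cross]
    rfl
  bracket_self p v := by rw [stage2_bracket_eq_cross, cross_self, Prod.mk_zero_zero]
  bracket_jacobi := stage2_jacobi I K
  bracket_smooth v w := by
    simp only [stage2_bracket_eq_cross]
    exact TorusSmooth.const _
  form_bilin p := ⟨0, fun X Y => by rw [stage2_form]; rfl⟩
  form_self p X := stage2_form I K p X X
  form_smooth X Y := by
    simp only [stage2_form]
    exact TorusSmooth.const _
  conn_bilin p := ⟨0, fun X v => by rw [stage2_conn]; rfl⟩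
  conn_smooth X v := by
    simp only [stage2_conn]
    exact TorusSmooth.const _
  section_jacobi x y z _ _ _ _ _ _ := by
    simp only [stage2_sectionBracket]
    refine Prod.ext (Subsingleton.elim _ _) (funext fun p => stage2_jacobi I K p _ _ _)


/-! ### Inertia tensors and the kinetic energy -/

theorem transpose_eq_of_posDef {A : Mat3} (hA : A.PosDef) : Aᵀ = A := by
  rw [← Matrix.conjTranspose_eq_transpose_of_trivial]
  exact hA.isHermitian

theorem dotProduct_mulVec_symm {A : Mat3} (hA : Aᵀ = A) (v w : V3) :
    v ⬝ᵥ (A *ᵥ w) = (A *ᵥ v) ⬝ᵥ w := by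
  rw [Matrix.dotProduct_mulVec, ← Matrix.mulVec_transpose, hA]

theorem dotProduct_rotorInertia {I K : Mat3} (hK : K.PosDef) (u : V3) :
    (K *ᵥ u) ⬝ᵥ ((I + K)⁻¹ *ᵥ (I *ᵥ u)) = u ⬝ᵥ ((K * (I + K)⁻¹ * I) *ᵥ u) := by
  rw [← dotProduct_mulVec_symm (transpose_eq_of_posDef hK), Matrix.mulVec_mulVec,
    Matrix.mulVec_mulVec, Matrix.mul_assoc]

section PosDef

variable {I K : Mat3} (hI : I.PosDef) (hK : K.PosDef)
include hI hK

theorem isUnit_det_add : IsUnit (I + K).det :=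
  (Matrix.isUnit_iff_isUnit_det _).1 (hI.add hK).isUnit

theorem add_mulVec_ratio (v : V3) : (I + K) *ᵥ (((I + K)⁻¹ * K) *ᵥ v) = K *ᵥ v := by
  rw [Matrix.mulVec_mulVec, Matrix.mul_nonsing_inv_cancel_left _ _ (isUnit_det_add hI hK)]

theorem add_mulVec_injective : Function.Injective ((I + K) *ᵥ ·) :=
  Matrix.mulVec_injective_iff_isUnit.2 (hI.add hK).isUnit

theorem transpose_inv_add : ((I + K)⁻¹)ᵀ = (I + K)⁻¹ :=
  transpose_eq_of_posDef (hI.add hK).inv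

/-- The reduced inertia tensor `K (I + K)⁻¹ I` of the rotors is symmetric: it equals
`K - K (I + K)⁻¹ K`. -/
theorem transpose_rotorInertia : (K * (I + K)⁻¹ * I)ᵀ = K * (I + K)⁻¹ * I := by
  have h : K * (I + K)⁻¹ * I = K - K * (I + K)⁻¹ * K := by
    rw [eq_sub_iff_add_eq, ← Matrix.mul_add, Matrix.mul_assoc,
      Matrix.nonsing_inv_mul _ (isUnit_det_add hI hK), Matrix.mul_one]
  rw [h, Matrix.transpose_sub, Matrix.transpose_mul, Matrix.transpose_mul,
    transpose_inv_add hI hK, transpose_eq_of_posDef hK, Matrix.mul_assoc]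

/-- `K (I + K)⁻¹`, the transpose of `M = (I + K)⁻¹ K`, is injective. -/
theorem mulVec_transpose_ratio_injective : Function.Injective ((K * (I + K)⁻¹) *ᵥ ·) :=
  Matrix.mulVec_injective_iff_isUnit.2
    (hK.isUnit.mul (Matrix.isUnit_nonsing_inv_iff.2 (hI.add hK).isUnit))

theorem dotProduct_ratio_mulVec (a X : V3) :
    a ⬝ᵥ (((I + K)⁻¹ * K) *ᵥ X) = ((K * (I + K)⁻¹) *ᵥ a) ⬝ᵥ X := by
  rw [Matrix.dotProduct_mulVec, ← Matrix.mulVec_transpose, Matrix.transpose_mul,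
    transpose_inv_add hI hK, transpose_eq_of_posDef hK]

/-- The mechanical connection vanishes exactly on the metric complement of the group orbits:
`⟨v, ζ_Q⟩ = ζ · R ((I + K) Ω + K θ̇)`. -/
theorem mechConnection_eq_zero_iff (q : Q) (v : tangentQ q) :
    mechConnection I K q v = 0 ↔ ∀ ζ, metric I K q v (generator ζ q) = 0 := by
  have hm : ∀ ζ, metric I K q v (generator ζ q)
      = (((q.1 : Mat3)ᵀ) *ᵥ ζ) ⬝ᵥ
        ((I + K) *ᵥ (bodyVel q v + ((I + K)⁻¹ * K) *ᵥ rotorVel q v)) := by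
    intro ζ
    rw [metric, bodyVel_generator, rotorVel_generator, Matrix.mulVec_add (I + K),
      add_mulVec_ratio hI hK, Matrix.add_mulVec, Matrix.mulVec_add, add_zero, ← dotProduct_add,
      add_assoc]
  constructor
  · intro h ζ
    rw [hm, ← Ad_inv_mechConnection, h, map_zero, Matrix.mulVec_zero, dotProduct_zero]
  · intro h
    have h₀ : (I + K) *ᵥ (bodyVel q v + ((I + K)⁻¹ * K) *ᵥ rotorVel q v) = 0 := by
      refine dotProduct_eq_zero _ fun w => ?_
      have := h ((q.1 : Mat3) *ᵥ w)
      rwa [hm, SO3.transpose_mulVec_mulVec, dotProduct_comm] at this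
    rw [mechConnection_apply,
      add_mulVec_injective hI hK (h₀.trans (Matrix.mulVec_zero (I + K)).symm), Matrix.mulVec_zero]

/-- Completing the square in the kinetic energy decouples `ξ = Ω + M θ̇` from `θ̇`. -/
theorem lagrangian_eq_lagr1 (q : Q) (v : tangentQ q) :
    lagrangian I K q v
      = lagr1 I K q.2 (rotorVel q v) (Ad q.1⁻¹ (mechConnection I K q v)) := by
  rw [Ad_inv_mechConnection, lagrangian, lagr1]
  generalize bodyVel q v = Ω
  generalize rotorVel q v = r
  have hKt := transpose_eq_of_posDef hK
  have h₁ : (I + K) *ᵥ (Ω + ((I + K)⁻¹ * K) *ᵥ r) = I *ᵥ Ω + K *ᵥ Ω + K *ᵥ r := by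
    rw [Matrix.mulVec_add, add_mulVec_ratio hI hK, Matrix.add_mulVec]
  have h₂ : (K *ᵥ r) ⬝ᵥ ((I + K)⁻¹ *ᵥ (I *ᵥ r))
      = r ⬝ᵥ (K *ᵥ r) - (((I + K)⁻¹ * K) *ᵥ r) ⬝ᵥ (K *ᵥ r) := by
    have h : (I + K)⁻¹ *ᵥ (I *ᵥ r) = r - ((I + K)⁻¹ * K) *ᵥ r := by
      rw [eq_sub_iff_add_eq, Matrix.mulVec_mulVec, ← Matrix.add_mulVec, ← Matrix.mul_add,
        Matrix.nonsing_inv_mul _ (isUnit_det_add hI hK), Matrix.one_mulVec]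
    rw [h, dotProduct_comm, sub_dotProduct]
  have h₃ : (((I + K)⁻¹ * K) *ᵥ r) ⬝ᵥ (I *ᵥ Ω) + (((I + K)⁻¹ * K) *ᵥ r) ⬝ᵥ (K *ᵥ Ω)
      = r ⬝ᵥ (K *ᵥ Ω) := by
    rw [← dotProduct_add, ← Matrix.add_mulVec,
      dotProduct_mulVec_symm (transpose_eq_of_posDef (hI.add hK)), add_mulVec_ratio hI hK,
      ← dotProduct_mulVec_symm hKt]
  have h₄ : Ω ⬝ᵥ (K *ᵥ r) = r ⬝ᵥ (K *ᵥ Ω) := by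
    rw [dotProduct_mulVec_symm hKt, dotProduct_comm]
  rw [h₁, h₂, Matrix.mulVec_add]
  simp only [add_dotProduct, dotProduct_add]
  linarith

end PosDef

theorem lagrangian_eq_metric (I K : Mat3) (q : Q) (v : tangentQ q) :
    lagrangian I K q v = 1 / 2 * metric I K q v v := by
  rw [lagrangian, metric, mul_add]

/-! ### The Lagrange-Poincare equations -/

/-- The covector `v ↦ a · v`. -/
noncomputable def dotCLM (a : V3) : V3 →L[ℝ] ℝ :=
  LinearMap.toContinuousLinearMap (dotProductBilin ℝ ℝ a)

theorem hasFDerivAt_half_quadratic {E : Type*} [NormedAddCommGroup E] [NormedSpace ℝ E] {A : Mat3}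
    (hA : Aᵀ = A) (T : E →L[ℝ] V3) (v : E) :
    HasFDerivAt (fun w => 1 / 2 * (T w ⬝ᵥ (A *ᵥ T w))) ((dotCLM (A *ᵥ T v)).comp T) v := by
  let B : V3 →L[ℝ] V3 →L[ℝ] ℝ :=
    LinearMap.toContinuousBilinearMap (Matrix.toLinearMap₂' ℝ A : V3 →ₗ[ℝ] V3 →ₗ[ℝ] ℝ)
  have hB : ∀ x y, B x y = x ⬝ᵥ (A *ᵥ y) := fun x y => Matrix.toLinearMap₂'_apply' A x y
  have h := (B.hasFDerivAt_of_bilinear (T.hasFDerivAt (x := v))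
    (T.hasFDerivAt (x := v))).const_mul (1 / 2 : ℝ)
  simp only [hB] at h
  refine h.congr_fderiv (ContinuousLinearMap.ext fun w => ?_)
  change 1 / 2 * (B (T v) (T w) + B (T w) (T v)) = (A *ᵥ T v) ⬝ᵥ T w
  rw [hB, hB, dotProduct_mulVec_symm hA, dotProduct_comm (T w)]
  ring

theorem hasDerivAt_mulVec_dotProduct (A : Mat3) (α : V3) {f : ℝ → V3} {t : ℝ}
    (hf : DifferentiableAt ℝ f t) :
    HasDerivAt (fun s => (A *ᵥ f s) ⬝ᵥ α) ((A *ᵥ deriv f t) ⬝ᵥ α) t := by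
  have h := (dotCLM α).hasFDerivAt.comp_hasDerivAt t (hasDerivAt_mulVec A hf.hasDerivAt)
  simp only [dotProduct_comm _ α]
  exact h

theorem dotProduct_cross_assoc (a b c : V3) : a ⬝ᵥ b ⨯₃ c = (a ⨯₃ b) ⬝ᵥ c := by
  rw [triple_product_permutation, triple_product_permutation, dotProduct_comm]

theorem forall_dotProduct_eq_iff {a b : V3} : (∀ α, a ⬝ᵥ α = b ⬝ᵥ α) ↔ a = b :=
  ⟨dotProduct_eq a b, fun h _ => by rw [h]⟩

theorem forall_dotProduct_add_eq_iff {a b a' b' : V3} :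
    (∀ α : V3 × V3, a ⬝ᵥ α.1 + b ⬝ᵥ α.2 = a' ⬝ᵥ α.1 + b' ⬝ᵥ α.2) ↔ a = a' ∧ b = b' := by
  constructor
  · intro h
    exact ⟨dotProduct_eq _ _ fun α => by simpa using h (α, 0),
      dotProduct_eq _ _ fun α => by simpa using h (0, α)⟩
  · rintro ⟨rfl, rfl⟩ α
    rfl

section Equations

variable {I K : Mat3} (hI : I.PosDef) (hK : K.PosDef)
include hI hK

theorem dFiber_lagr1 (θ : Torus 3) (u ξ α : V3) :
    dFiber (lagr1 I K) θ u ξ α = ((I + K) *ᵥ ξ) ⬝ᵥ α := by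
  have h := (hasFDerivAt_half_quadratic (transpose_eq_of_posDef (hI.add hK))
    (ContinuousLinearMap.id ℝ V3) ξ).add_const (1 / 2 * ((K *ᵥ u) ⬝ᵥ ((I + K)⁻¹ *ᵥ (I *ᵥ u))))
  exact congrArg (fun T => T α) h.fderiv

theorem dVel_lagr1 (θ : Torus 3) (u ξ X : V3) :
    dVel (lagr1 I K) θ u ξ X = ((K * (I + K)⁻¹ * I) *ᵥ u) ⬝ᵥ X := by
  have h := (hasFDerivAt_half_quadratic (transpose_rotorInertia hI hK)
    (ContinuousLinearMap.id ℝ V3) u).const_add (1 / 2 * (ξ ⬝ᵥ ((I + K) *ᵥ ξ)))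
  simp only [ContinuousLinearMap.id_apply, ← dotProduct_rotorInertia hK] at h
  exact congrArg (fun T => T X) h.fderiv

/-- `lagr1` does not depend on `θ`; its derivative along a horizontal lift comes from the
change of `ξ` under parallel transport. -/
theorem dBase_lagr1 (θ : Torus 3) (u ξ X : V3) :
    (stage1 I K).dBase (lagr1 I K) θ u ξ X
      = ((I + K) *ᵥ ξ) ⬝ᵥ ((((I + K)⁻¹ * K) *ᵥ X) ⨯₃ ξ) := by
  set w := (((I + K)⁻¹ * K) *ᵥ X) ⨯₃ ξ with hw
  have h₀ : HasDerivAt (fun s : ℝ => ξ + s • w) w 0 := by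
    simpa using ((hasDerivAt_id (0 : ℝ)).smul_const w).const_add ξ
  have h₁ := ((hasFDerivAt_half_quadratic (transpose_eq_of_posDef (hI.add hK))
    (ContinuousLinearMap.id ℝ V3) (ξ + (0 : ℝ) • w)).add_const
      (1 / 2 * ((K *ᵥ u) ⬝ᵥ ((I + K)⁻¹ *ᵥ (I *ᵥ u))))).comp_hasDerivAt (0 : ℝ) h₀
  rw [zero_smul, add_zero] at h₁
  simp only [LPStructure.dBase, stage1_conn, ← hw, smul_neg, sub_neg_eq_add]
  exact h₁.deriv

theorem stage1_verticalEq_iff (θ : ℝ → Torus 3) (u ξ : ℝ → V3) (t : ℝ)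
    (hξ : DifferentiableAt ℝ ξ t) :
    (stage1 I K).VerticalEq (lagr1 I K) θ u ξ t ↔
      (I + K) *ᵥ deriv ξ t = ((I + K) *ᵥ ξ t) ⨯₃ (ξ t - ((I + K)⁻¹ * K) *ᵥ u t) := by
  rw [← forall_dotProduct_eq_iff]
  refine forall_congr' fun α => ?_
  simp only [dFiber_lagr1 hI hK, (hasDerivAt_mulVec_dotProduct (I + K) α hξ).deriv,
    LPStructure.covDeriv, deriv_const, zero_add, stage1_conn, stage1_bracket, dotProduct_neg,
    dotProduct_cross_assoc, map_sub, sub_dotProduct]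
  rw [sub_neg_eq_add, eq_sub_iff_add_eq]

/-- The horizontal equation pairs `(K (I + K)⁻¹) (I θ̈ + ((I + K) ξ) × Ω)` with an arbitrary vector,
and `K (I + K)⁻¹` is the transpose of `M` and invertible. -/
theorem stage1_horizontalEq_iff (θ : ℝ → Torus 3) (u ξ : ℝ → V3) (t : ℝ)
    (hu : DifferentiableAt ℝ u t) :
    (stage1 I K).HorizontalEq (lagr1 I K) θ u ξ t ↔
      I *ᵥ deriv u t = -(((I + K) *ᵥ ξ t) ⨯₃ (ξ t - ((I + K)⁻¹ * K) *ᵥ u t)) := by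
  rw [← (mulVec_transpose_ratio_injective hI hK).eq_iff, ← forall_dotProduct_eq_iff]
  refine forall_congr' fun X => ?_
  simp only [dVel_lagr1 hI hK, dFiber_lagr1 hI hK, dBase_lagr1 hI hK, stage1_form,
    (hasDerivAt_mulVec_dotProduct (K * (I + K)⁻¹ * I) X hu).deriv]
  rw [← cross_anticomm (ξ t), ← cross_anticomm (((I + K)⁻¹ * K) *ᵥ u t)]
  simp only [dotProduct_neg, dotProduct_cross_assoc, dotProduct_ratio_mulVec hI hK,
    Matrix.mulVec_mulVec, Matrix.mulVec_neg, Matrix.mulVec_sub, map_sub, neg_dotProduct,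
    sub_dotProduct]
  constructor <;> intro h <;> linarith

theorem dFiber_lagr2 (p : Torus 0) (o : Fin 0 → ℝ) (x α : V3 × V3) :
    dFiber (lagr2 I K) p o x α
      = ((K * (I + K)⁻¹ * I) *ᵥ x.1) ⬝ᵥ α.1 + ((I + K) *ᵥ x.2) ⬝ᵥ α.2 := by
  have h := (hasFDerivAt_half_quadratic (transpose_eq_of_posDef (hI.add hK))
    (ContinuousLinearMap.snd ℝ V3 V3) x).add (hasFDerivAt_half_quadratic
      (transpose_rotorInertia hI hK) (ContinuousLinearMap.fst ℝ V3 V3) x)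
  simp only [← dotProduct_rotorInertia hK] at h
  rw [add_comm]
  exact congrArg (fun T => T α) h.fderiv

theorem stage2_verticalEq_iff (Ωr ξ : ℝ → V3) (t : ℝ) (hΩr : DifferentiableAt ℝ Ωr t)
    (hξ : DifferentiableAt ℝ ξ t) :
    (stage2 I K).VerticalEq (lagr2 I K) (fun _ => 0) (fun _ => 0) (fun s => (Ωr s, ξ s)) t ↔
      I *ᵥ deriv Ωr t = -(((I + K) *ᵥ ξ t) ⨯₃ (ξ t - ((I + K)⁻¹ * K) *ᵥ Ωr t)) ∧
        (I + K) *ᵥ deriv ξ t = ((I + K) *ᵥ ξ t) ⨯₃ (ξ t - ((I + K)⁻¹ * K) *ᵥ Ωr t) := by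
  rw [← (mulVec_transpose_ratio_injective hI hK).eq_iff, ← forall_dotProduct_add_eq_iff]
  refine forall_congr' fun α => ?_
  simp only [dFiber_lagr2 hI hK, ((hasDerivAt_mulVec_dotProduct (K * (I + K)⁻¹ * I) α.1 hΩr).fun_add
    (hasDerivAt_mulVec_dotProduct (I + K) α.2 hξ)).deriv, LPStructure.covDeriv, deriv_const,
    stage2_conn, stage2_bracket_eq_cross, Prod.fst_zero, Prod.snd_zero,
    add_zero, dotProduct_zero, zero_add, sub_zero, dotProduct_cross_assoc, dotProduct_sub,
    dotProduct_ratio_mulVec hI hK, Matrix.mulVec_mulVec, Matrix.mulVec_neg, neg_dotProduct]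
  constructor <;> intro h <;> linarith

end Equations

theorem stage2_horizontalEq (I K : Mat3) (x : ℝ → V3 × V3) (t : ℝ) :
    (stage2 I K).HorizontalEq (lagr2 I K) (fun _ => 0) (fun _ => 0) x t := by
  intro X
  rw [Subsingleton.elim X 0, stage2_form, map_zero, add_zero]
  simp only [map_zero, LPStructure.dBase, stage2_conn, smul_zero, sub_zero, lagr2, deriv_const]

theorem dFiber_lagrEP {I K : Mat3} (hI : I.PosDef) (hK : K.PosDef) (p : Torus 0) (o : Fin 0 → ℝ)
    (x α : V3 × V3) :
    dFiber (lagrEP I K) p o x α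
      = ((I + K) *ᵥ x.1 + K *ᵥ x.2) ⬝ᵥ α.1 + (K *ᵥ x.2 + K *ᵥ x.1) ⬝ᵥ α.2 := by
  have h := (hasFDerivAt_half_quadratic (transpose_eq_of_posDef hI)
    (ContinuousLinearMap.fst ℝ V3 V3) x).add (hasFDerivAt_half_quadratic
      (transpose_eq_of_posDef hK)
      (ContinuousLinearMap.fst ℝ V3 V3 + ContinuousLinearMap.snd ℝ V3 V3) x)
  refine (congrArg (fun T => T α) h.fderiv).trans ?_
  change (I *ᵥ x.1) ⬝ᵥ α.1 + (K *ᵥ (x.1 + x.2)) ⬝ᵥ (α.1 + α.2) = _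
  simp only [Matrix.mulVec_add, Matrix.add_mulVec, add_dotProduct, dotProduct_add]
  ring

theorem eulerPoincare_verticalEq_iff {I K : Mat3} (hI : I.PosDef) (hK : K.PosDef)
    (Ω Ωr : ℝ → V3) (t : ℝ) (hΩ : DifferentiableAt ℝ Ω t) (hΩr : DifferentiableAt ℝ Ωr t) :
    eulerPoincare.VerticalEq (lagrEP I K) (fun _ => 0) (fun _ => 0) (fun s => (Ω s, Ωr s)) t ↔
      (I + K) *ᵥ deriv Ω t + K *ᵥ deriv Ωr t = ((I + K) *ᵥ Ω t + K *ᵥ Ωr t) ⨯₃ Ω t ∧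
        K *ᵥ deriv Ωr t + K *ᵥ deriv Ω t = 0 := by
  rw [← forall_dotProduct_add_eq_iff]
  refine forall_congr' fun α => ?_
  simp only [dFiber_lagrEP hI hK, add_dotProduct]
  rw [(((hasDerivAt_mulVec_dotProduct (I + K) α.1 hΩ).fun_add
    (hasDerivAt_mulVec_dotProduct K α.1 hΩr)).fun_add
      ((hasDerivAt_mulVec_dotProduct K α.2 hΩr).fun_add
        (hasDerivAt_mulVec_dotProduct K α.2 hΩ))).deriv]
  simp only [LPStructure.covDeriv, deriv_const, eulerPoincare,
    Prod.fst_zero, Prod.snd_zero, add_zero, dotProduct_zero, sub_zero, dotProduct_cross_assoc,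
    zero_dotProduct, ← add_dotProduct, ← LinearMap.add_apply, ← map_add]

/-! ### Equivalence of the reduced systems -/

section Equivalence

variable {I K : Mat3} (hI : I.PosDef) (hK : K.PosDef)
include hI hK

/-- With `ξ = Ω + M Ω_r` the body angular velocity is recovered as `ξ - M Ω_r`, and `(I + K) ξ` is
the total body angular momentum `(I + K) Ω + K Ω_r`. -/
theorem momentum_eq {Ω Ωr ξ : ℝ → V3} {t : ℝ}
    (hξ : ∀ s, ξ s = Ω s + ((I + K)⁻¹ * K) *ᵥ Ωr s)
    (hΩ : DifferentiableAt ℝ Ω t) (hΩr : DifferentiableAt ℝ Ωr t) :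
    DifferentiableAt ℝ ξ t ∧
      (I + K) *ᵥ deriv ξ t = (I + K) *ᵥ deriv Ω t + K *ᵥ deriv Ωr t ∧
      ((I + K) *ᵥ ξ t) ⨯₃ (ξ t - ((I + K)⁻¹ * K) *ᵥ Ωr t)
        = ((I + K) *ᵥ Ω t + K *ᵥ Ωr t) ⨯₃ Ω t := by
  have h : HasDerivAt ξ (deriv Ω t + ((I + K)⁻¹ * K) *ᵥ deriv Ωr t) t := by
    rw [funext hξ]
    exact hΩ.hasDerivAt.add (hasDerivAt_mulVec _ hΩr.hasDerivAt)
  refine ⟨h.differentiableAt, ?_, ?_⟩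
  · rw [h.deriv, Matrix.mulVec_add, add_mulVec_ratio hI hK]
  · rw [hξ t, add_sub_cancel_right, Matrix.mulVec_add, add_mulVec_ratio hI hK]

/-- Given the equation for the total momentum, the rotor equation `I Ω_r' = -P` is conservation of
the rotor momentum `K (Ω_r + Ω)`: adding the two gives `(I + K) (Ω_r + Ω)' = 0`. -/
theorem rotor_eq_iff {a r P : V3} (h : (I + K) *ᵥ a + K *ᵥ r = P) :
    I *ᵥ r = -P ↔ K *ᵥ r + K *ᵥ a = 0 := by
  have hJ : I *ᵥ r + P = (I + K) *ᵥ (r + a) := by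
    rw [← h, Matrix.mulVec_add, Matrix.add_mulVec I K r]
    abel
  rw [eq_neg_iff_add_eq_zero, hJ, ← Matrix.mulVec_add]
  constructor <;> intro h₀
  · rw [add_mulVec_injective hI hK (h₀.trans (Matrix.mulVec_zero (I + K)).symm),
      Matrix.mulVec_zero]
  · rw [Matrix.mulVec_injective_iff_isUnit.2 hK.isUnit (h₀.trans (Matrix.mulVec_zero K).symm),
      Matrix.mulVec_zero]

/-- Both reduced systems are the Euler-Poincare equations in the variables `ξ = Ω + M Ω_r`; the
vertical equation of the first stage is the balance of total angular momentum. -/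
theorem reduced_equations_equivalence (θ : ℝ → Torus 3) (Ω Ωr ξ : ℝ → V3) (t : ℝ)
    (hξ : ∀ s, ξ s = Ω s + ((I + K)⁻¹ * K) *ᵥ Ωr s)
    (hΩ : DifferentiableAt ℝ Ω t) (hΩr : DifferentiableAt ℝ Ωr t) :
    ((stage1 I K).VerticalEq (lagr1 I K) θ Ωr ξ t ↔
        (I + K) *ᵥ deriv Ω t + K *ᵥ deriv Ωr t = ((I + K) *ᵥ Ω t + K *ᵥ Ωr t) ⨯₃ Ω t) ∧
      ((stage1 I K).VerticalEq (lagr1 I K) θ Ωr ξ t ∧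
          (stage1 I K).HorizontalEq (lagr1 I K) θ Ωr ξ t ↔
        eulerPoincare.VerticalEq (lagrEP I K) (fun _ => 0) (fun _ => 0)
          (fun s => (Ω s, Ωr s)) t) ∧
      ((stage2 I K).VerticalEq (lagr2 I K) (fun _ => 0) (fun _ => 0) (fun s => (Ωr s, ξ s)) t ↔
        eulerPoincare.VerticalEq (lagrEP I K) (fun _ => 0) (fun _ => 0)
          (fun s => (Ω s, Ωr s)) t) := by
  obtain ⟨hd, hJ, hP⟩ := momentum_eq hI hK hξ hΩ hΩr
  rw [stage1_verticalEq_iff hI hK θ Ωr ξ t hd, stage1_horizontalEq_iff hI hK θ Ωr ξ t hΩr,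
    stage2_verticalEq_iff hI hK Ωr ξ t hΩr hd, eulerPoincare_verticalEq_iff hI hK Ω Ωr t hΩ hΩr,
    hJ, hP]
  have key := and_congr_right fun h => rotor_eq_iff hI hK (a := deriv Ω t) (r := deriv Ωr t)
    (P := ((I + K) *ᵥ Ω t + K *ᵥ Ωr t) ⨯₃ Ω t) h
  exact ⟨Iff.rfl, key, and_comm.trans key⟩

end Equivalence

end Rotor

theorem mainTheorem4 (I K : Matrix (Fin 3) (Fin 3) ℝ) (hI : I.PosDef) (hK : K.PosDef) :
    -- the connection is the mechanical connection of `Q → T³`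
    Rotor.IsPrincipalConnection (Rotor.mechConnection I K) ∧
    (∀ q v, Rotor.lagrangian I K q v = 1 / 2 * Rotor.metric I K q v v) ∧
    (∀ q v, Rotor.mechConnection I K q v = 0 ↔
      ∀ ζ, Rotor.metric I K q v (Rotor.generator ζ q) = 0) ∧
    (∀ q v, Rotor.Ad q.1⁻¹ (Rotor.mechConnection I K q v)
      = Rotor.bodyVel q v + ((I + K)⁻¹ * K) *ᵥ Rotor.rotorVel q v) ∧
    -- the induced isomorphism `TQ / SO(3) ≅ T(T³) ⊕ (T³ × so(3))`
    (∃ e : Rotor.TQmodSO3 ≃ Rotor.Torus 3 × Rotor.V3 × Rotor.V3, ∀ q v,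
      e (Quot.mk _ ⟨q, v⟩)
        = (q.2, Rotor.rotorVel q v, Rotor.Ad q.1⁻¹ (Rotor.mechConnection I K q v))) ∧
    (∀ q, ∃ e : Rotor.tangentQ q ≃ₗ[ℝ] Rotor.V3 × Rotor.V3, ∀ v,
      e v = (Rotor.rotorVel q v, Rotor.Ad q.1⁻¹ (Rotor.mechConnection I K q v))) ∧
    -- trivialization of the adjoint bundle, with its bracket, 2-form and connection
    (∃ e : Rotor.AdjointBundle ≃ Rotor.Torus 3 × Rotor.V3,
      (∀ q ζ, e (Rotor.adjMk q ζ) = (q.2, Rotor.Ad q.1⁻¹ ζ)) ∧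
      (∀ q ζ₁ ζ₂, (e (Rotor.adjMk q (ζ₁ ⨯₃ ζ₂))).2
        = (Rotor.stage1 I K).bracket q.2 (e (Rotor.adjMk q ζ₁)).2 (e (Rotor.adjMk q ζ₂)).2) ∧
      (∀ q X Y, (e (Rotor.adjMk q (Rotor.curvature (Rotor.mechConnection I K) q
            (Rotor.horLift (Rotor.mechConnection I K) q X)
            (Rotor.horLift (Rotor.mechConnection I K) q Y)))).2
        = (Rotor.stage1 I K).form q.2 X Y) ∧
      (∀ (q : ℝ → Rotor.Q) (v : ∀ s, Rotor.tangentQ (q s)) (ζ : ℝ → Rotor.V3) (t : ℝ),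
        Rotor.HasVelocityAt q t (v t) → DifferentiableAt ℝ ζ t →
        (e (Rotor.adjMk (q t)
            (deriv ζ t - Rotor.mechConnection I K (q t) (v t) ⨯₃ ζ t))).2
          = (Rotor.stage1 I K).covDeriv (fun s => (q s).2) (fun s => Rotor.rotorVel (q s) (v s))
              (fun s => (e (Rotor.adjMk (q s) (ζ s))).2) t)) ∧
    -- explicit form of the first reduced bundle; the curvature term is nonzero
    (∀ θ α β, (Rotor.stage1 I K).bracket θ α β = α ⨯₃ β) ∧
    (∀ θ u α, (Rotor.stage1 I K).conn θ u α = -((((I + K)⁻¹ * K) *ᵥ u) ⨯₃ α)) ∧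
    (∀ θ X Y, (Rotor.stage1 I K).form θ X Y
      = (((I + K)⁻¹ * K) *ᵥ Y) ⨯₃ (((I + K)⁻¹ * K) *ᵥ X)) ∧
    (∀ θ, ∃ X Y, (Rotor.stage1 I K).form θ X Y ≠ 0) ∧
    (Rotor.stage1 I K).IsLP ∧
    -- the decoupled reduced Lagrangian of the first stage
    (∀ q v, Rotor.lagrangian I K q v
      = Rotor.lagr1 I K q.2 (Rotor.rotorVel q v)
          (Rotor.Ad q.1⁻¹ (Rotor.mechConnection I K q v))) ∧
    -- the Lagrange-Poincare equations of the first stage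
    (∀ (θ : ℝ → Rotor.Torus 3) (u ξ : ℝ → Rotor.V3) (t : ℝ),
      (∀ᶠ s in 𝓝 t, Rotor.HasTorusVelocityAt θ (u s) s) →
      DifferentiableAt ℝ u t → DifferentiableAt ℝ ξ t →
      ((Rotor.stage1 I K).VerticalEq (Rotor.lagr1 I K) θ u ξ t ↔
        (I + K) *ᵥ deriv ξ t
          = ((I + K) *ᵥ ξ t) ⨯₃ (ξ t - ((I + K)⁻¹ * K) *ᵥ u t)) ∧
      ((Rotor.stage1 I K).HorizontalEq (Rotor.lagr1 I K) θ u ξ t ↔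
        I *ᵥ deriv u t
          = -(((I + K) *ᵥ ξ t) ⨯₃ (ξ t - ((I + K)⁻¹ * K) *ᵥ u t)))) ∧
    -- the action of `T³` preserves the first reduced bundle and its Lagrangian
    (∀ φ θ : Rotor.Torus 3,
      (Rotor.stage1 I K).bracket (θ + φ) = (Rotor.stage1 I K).bracket θ ∧
      (Rotor.stage1 I K).form (θ + φ) = (Rotor.stage1 I K).form θ ∧
      (Rotor.stage1 I K).conn (θ + φ) = (Rotor.stage1 I K).conn θ ∧
      Rotor.lagr1 I K (θ + φ) = Rotor.lagr1 I K θ) ∧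
    (∃ e : Rotor.Stage1modT3 ≃ Rotor.V3 × Rotor.V3, ∀ θ u ξ,
      e (Quot.mk _ (θ, u, ξ)) = (u, ξ)) ∧
    -- the second reduced bundle, over a point, with its twisted bracket
    (∀ p X x, (Rotor.stage2 I K).conn p X x = 0) ∧
    (∀ p X Y, (Rotor.stage2 I K).form p X Y = 0) ∧
    (∀ p a₁ ξ₁ a₂ ξ₂, (Rotor.stage2 I K).bracket p (a₁, ξ₁) (a₂, ξ₂)
      = (0, -((((I + K)⁻¹ * K) *ᵥ a₁) ⨯₃ ξ₂) + (((I + K)⁻¹ * K) *ᵥ a₂) ⨯₃ ξ₁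
          - (((I + K)⁻¹ * K) *ᵥ a₂) ⨯₃ (((I + K)⁻¹ * K) *ᵥ a₁) + ξ₁ ⨯₃ ξ₂)) ∧
    (Rotor.stage2 I K).IsLP ∧
    (∀ θ u ξ p o, Rotor.lagr1 I K θ u ξ = Rotor.lagr2 I K p o (u, ξ)) ∧
    -- the vertical equations of the second stage; there is no horizontal equation
    (∀ (Ωr ξ : ℝ → Rotor.V3) (t : ℝ), DifferentiableAt ℝ Ωr t → DifferentiableAt ℝ ξ t →
      ((Rotor.stage2 I K).VerticalEq (Rotor.lagr2 I K) (fun _ => 0) (fun _ => 0)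
          (fun s => (Ωr s, ξ s)) t ↔
        I *ᵥ deriv Ωr t
            = -(((I + K) *ᵥ ξ t) ⨯₃ (ξ t - ((I + K)⁻¹ * K) *ᵥ Ωr t)) ∧
          (I + K) *ᵥ deriv ξ t
            = ((I + K) *ᵥ ξ t) ⨯₃ (ξ t - ((I + K)⁻¹ * K) *ᵥ Ωr t)) ∧
      (Rotor.stage2 I K).HorizontalEq (Rotor.lagr2 I K) (fun _ => 0) (fun _ => 0)
        (fun s => (Ωr s, ξ s)) t) ∧
    -- equivalence with the Euler-Poincare equations along curves in `Q`
    (∀ q v p o, Rotor.lagrangian I K q v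
      = Rotor.lagrEP I K p o (Rotor.bodyVel q v, Rotor.rotorVel q v)) ∧
    (∀ (q : ℝ → Rotor.Q) (v : ∀ s, Rotor.tangentQ (q s)) (θ : ℝ → Rotor.Torus 3)
      (Ω Ωr ξ : ℝ → Rotor.V3) (t : ℝ),
      (∀ᶠ s in 𝓝 t, Rotor.HasVelocityAt q s (v s)) →
      (∀ s, θ s = (q s).2) →
      (∀ s, Ω s = Rotor.bodyVel (q s) (v s)) →
      (∀ s, Ωr s = Rotor.rotorVel (q s) (v s)) →
      (∀ s, ξ s = Rotor.Ad (q s).1⁻¹ (Rotor.mechConnection I K (q s) (v s))) →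
      DifferentiableAt ℝ Ω t → DifferentiableAt ℝ Ωr t →
      (Rotor.eulerPoincare.VerticalEq (Rotor.lagrEP I K) (fun _ => 0) (fun _ => 0)
          (fun s => (Ω s, Ωr s)) t ↔
        (I + K) *ᵥ deriv Ω t + K *ᵥ deriv Ωr t
            = ((I + K) *ᵥ Ω t + K *ᵥ Ωr t) ⨯₃ Ω t ∧
          K *ᵥ deriv Ωr t + K *ᵥ deriv Ω t = 0) ∧
      ((Rotor.stage1 I K).VerticalEq (Rotor.lagr1 I K) θ Ωr ξ t ↔
        (I + K) *ᵥ deriv Ω t + K *ᵥ deriv Ωr t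
            = ((I + K) *ᵥ Ω t + K *ᵥ Ωr t) ⨯₃ Ω t) ∧
      ((Rotor.stage1 I K).VerticalEq (Rotor.lagr1 I K) θ Ωr ξ t ∧
          (Rotor.stage1 I K).HorizontalEq (Rotor.lagr1 I K) θ Ωr ξ t ↔
        Rotor.eulerPoincare.VerticalEq (Rotor.lagrEP I K) (fun _ => 0) (fun _ => 0)
          (fun s => (Ω s, Ωr s)) t) ∧
      ((Rotor.stage2 I K).VerticalEq (Rotor.lagr2 I K) (fun _ => 0) (fun _ => 0)
          (fun s => (Ωr s, ξ s)) t ↔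
        Rotor.eulerPoincare.VerticalEq (Rotor.lagrEP I K) (fun _ => 0) (fun _ => 0)
          (fun s => (Ω s, Ωr s)) t)) := by
  refine ⟨Rotor.isPrincipalConnection_mechConnection I K, Rotor.lagrangian_eq_metric I K,
    Rotor.mechConnection_eq_zero_iff hI hK, Rotor.Ad_inv_mechConnection I K,
    Rotor.exists_TQmodSO3_equiv I K, Rotor.exists_tangentQ_equiv I K,
    ⟨Rotor.adjointEquiv, fun q ζ => rfl, fun q ζ₁ ζ₂ => ?_, fun q X Y => ?_,
      Rotor.adjointEquiv_covDeriv I K⟩,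
    Rotor.stage1_bracket I K, Rotor.stage1_conn I K, Rotor.stage1_form I K,
    Rotor.exists_stage1_form_ne_zero hI hK, Rotor.stage1_isLP I K,
    Rotor.lagrangian_eq_lagr1 hI hK,
    fun θ u ξ t _ hu hξ => ⟨Rotor.stage1_verticalEq_iff hI hK θ u ξ t hξ,
      Rotor.stage1_horizontalEq_iff hI hK θ u ξ t hu⟩,
    fun φ θ => ⟨rfl, ?_, ?_, rfl⟩, Rotor.exists_Stage1modT3_equiv, Rotor.stage2_conn I K,
    Rotor.stage2_form I K, Rotor.stage2_bracket I K, Rotor.stage2_isLP I K,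
    fun θ u ξ p o => rfl,
    fun Ωr ξ t hΩr hξ => ⟨Rotor.stage2_verticalEq_iff hI hK Ωr ξ t hΩr hξ,
      Rotor.stage2_horizontalEq I K _ t⟩,
    fun q v p o => rfl, fun q v θ Ω Ωr ξ t _ _ hΩ hΩr hξ dΩ dΩr => ?_⟩
  · simp only [Rotor.adjointEquiv_adjMk, Rotor.SO3.transpose_mulVec_cross, Rotor.stage1_bracket]
  · rw [Rotor.adjointEquiv_adjMk, Rotor.curvature_horLift, Rotor.SO3.transpose_mulVec_mulVec,
      Rotor.stage1_form]
  · funext X Y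
    rw [Rotor.stage1_form, Rotor.stage1_form]
  · funext X α
    rw [Rotor.stage1_conn, Rotor.stage1_conn]
  · refine ⟨Rotor.eulerPoincare_verticalEq_iff hI hK Ω Ωr t dΩ dΩr,
      Rotor.reduced_equations_equivalence hI hK θ Ω Ωr ξ t (fun s => ?_) dΩ dΩr⟩
    rw [hξ, hΩ, hΩr, Rotor.Ad_inv_mechConnection]
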